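/- Let $\sigma,\alpha>0$ be real numbers. There are $n_0=n_0(\sigma,\alpha)$ and a function $w=w_{\sigma,\alpha}:\mathbb N\to\mathbb R$ with $w(n)\to\infty$ as $n\to\infty$ such that the following holds for all $\gamma\in(0,1)$ with $\alpha\log(1/\gamma)\le\sigma/30$, all integers $n\ge n_0$ and $2\le r\le\alpha\log n$, and all reals $m,D$ with $n^{1+\sigma}\le m\le n^{r n^{\sigma/4}}$ and $D>0$. Let $\mathcal H$ be an $r$-uniform hypergraph with $n$ vertices (without multiple edges) such that $$|\deg_{\mathcal H}(v)-D|\le n^{-\sigma}D\quad\text{for all } v\in V(\mathcal H),\qquad \deg_{\mathcal H}(u,v)\le n^{-\sigma}D\quad\text{for all } u\ne v\in V(\mathcal H),$$ where $\deg_{\mathcal H}(v)$ and $\deg_{\mathcal H}(u,v)$ denote the number of edges that contain $v$, respectively both $u$ and $v$. Put $q:=\lfloor rm/n\rfloor$ and $m_0:=\lfloor(1-\gamma)m\rfloor$, and consider the random greedy edge-colouring algorithm with colour set $[q]=\{1,\dots,q\}$: in step $i+1$ (for $i\ge0$) choose $e_{i+1}\in E(\mathcal H)$ uniformly at random (repetitions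 allowed, independently of the past), and then give this occurrence $e_{i+1}$ a colour chosen uniformly at random from all colours in $[q]$ that have not been assigned to an $e_j$ with $j\le i$ and $e_j\cap e_{i+1}\neq\emptyset$; the algorithm terminates as soon as some edge of $\mathcal H$ has no such available colour. For $S\subseteq V(\mathcal H)$, $v\in V(\mathcal H)$ and $c\in[q]$ let $$Q_S(i):=\{c\in[q]: c \text{ is not assigned to any } e_j \text{ with } 1\le j\le i \text{ and } e_j\cap S\ne\emptyset\},$$ $$Y_{v,c}(i):=\{f\in E(\mathcal H): v\in f \text{ and } c\in Q_{f\setminus\{v\}}(i)\}.$$ Further let $\hat q(s):=(1-s)^r q$, $\hat y(s):=(1-s)^{r-1}D$ and $\hat e(s):=(1-s)^{-9r}n^{-\sigma/3}$. Then, with probability at least $1-m^{-w(n)\,r}$, the algorithm completes $m_0$ steps and, for all integers $0\le i\le m_0$ and with $t:=i/m$, we have $\min_{e\in E(\mathcal H)}|Q_e(i)|>0$ and $$(1-\hat e(t))\,\hat q(t)\le|Q_e(i)|\le(1+\hat e(t))\,\hat q(t)\quad\text{for all } e\in E(\mathcal H),$$ $$(1-\hat e(t))\,\hat y(t)\le|Y_{v,c}(i)|\le(1+\hat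 e(t))\,\hat y(t)\quad\text{for all } v\in V(\mathcal H)\text{ and } c\in[q].$$ -/

import Mathlib

open Filter

noncomputable section

namespace RandomGreedyColouring

universe u

variable {α : Type u}

/-- The hypergraph `H` is `r`-uniform: every edge has exactly `r` vertices. -/
def IsUniform (H : Hypergraph α) (r : ℕ) : Prop :=
  ∀ e ∈ H.edgeSet, e.Finite ∧ e.ncard = r

/-- The degree of `v`: the number of edges that contain `v`. -/
def degree (H : Hypergraph α) (v : α) : ℕ :=
  {e ∈ H.edgeSet | v ∈ e}.ncard

/-- The codegree of `u` and `v`: the number of edges that contain both `u` and `v`. -/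
def codegree (H : Hypergraph α) (u v : α) : ℕ :=
  {e ∈ H.edgeSet | {u, v} ⊆ e}.ncard

/-- The history of the algorithm after `i` steps: the list `[(e₁, c₁), …, (eᵢ, cᵢ)]` of the chosen
edges together with the colours assigned to them, in order; the colour set is `Fin q`. -/
abbrev History (α : Type u) (q : ℕ) : Type u := List (Set α × Fin q)

open Classical in
/-- `Q_S`: the colours that have not been assigned to any chosen edge that meets `S`. -/
def availableColours {q : ℕ} (h : History α q) (S : Set α) : Finset (Fin q) :=
  {c : Fin q | ∀ p ∈ h, (p.1 ∩ S).Nonempty → p.2 ≠ c}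

/-- `Y_{v,c}`: the edges `f` that contain `v` and for which the colour `c` is available
at `f \ {v}`. -/
def availableEdges (H : Hypergraph α) {q : ℕ} (h : History α q) (v : α) (c : Fin q) :
    Set (Set α) :=
  {f ∈ H.edgeSet | v ∈ f ∧ c ∈ availableColours h (f \ {v})}

open Classical in
/-- One step of the random greedy colouring algorithm: choose an edge `e` uniformly at random (all
edges of `H` are eligible, also those chosen before), then choose a colour uniformly at random among
those available at `e`, and record the pair. If some edge of `H` has no available colour (or there
is no edge at all) the algorithm has terminated, and the history no longer changes. -/
def step [Finite α] (H : Hypergraph α) {q : ℕ} (h : History α q) : PMF (History α q) :=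
  if hh : H.edgeSet.Nonempty ∧ ∀ e ∈ H.edgeSet, (availableColours h e).Nonempty then
    haveI : Nonempty H.edgeSet := hh.1.to_subtype
    haveI : Fintype H.edgeSet := Fintype.ofFinite _
    (PMF.uniformOfFintype H.edgeSet).bind fun e =>
      (PMF.uniformOfFinset (availableColours h e.1) (hh.2 e.1 e.2)).map fun c => h ++ [(e.1, c)]
  else PMF.pure h

/-- The law of the history of the random greedy colouring algorithm with `q` colours after `i`
steps, started from the empty history. -/
def law [Finite α] (H : Hypergraph α) (q : ℕ) : ℕ → PMF (History α q)
  | 0 => PMF.pure []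
  | i + 1 => (law H q i).bind (step H)

/-- The trajectory `q̂(s) = (1 - s)^r q`. -/
def qHat (r q : ℕ) (s : ℝ) : ℝ := (1 - s) ^ r * q

/-- The trajectory `ŷ(s) = (1 - s)^(r-1) D`, used for `r ≥ 2` only. -/
def yHat (r : ℕ) (D s : ℝ) : ℝ := (1 - s) ^ (r - 1) * D

/-- The relative error `ê(s) = (1 - s)^(-9r) n^(-σ/3)`. -/
def eHat (n r : ℕ) (σ s : ℝ) : ℝ := (1 - s) ^ (-(9 * (r : ℝ))) * (n : ℝ) ^ (-(σ / 3))

/-- `x = (1 ± ε) y`, that is, `(1 - ε) y ≤ x ≤ (1 + ε) y`. -/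
def IsApprox (x ε y : ℝ) : Prop := (1 - ε) * y ≤ x ∧ x ≤ (1 + ε) * y

/-- The event, for a history `h`, that the algorithm has run for `N` steps, and for all `0 ≤ i ≤ N`,
with `t = i / m` and `h.take i` the history after `i` steps, every edge has an available colour
and all the variables `|Q_e(i)|` and `|Y_{v,c}(i)|` are close to their trajectories. -/
def Concentrated (H : Hypergraph α) (n r q : ℕ) (σ m D : ℝ) (N : ℕ) (h : History α q) : Prop :=
  h.length = N ∧
  ∀ i : ℕ, i ≤ N →
    (∀ e ∈ H.edgeSet, 0 < (availableColours (h.take i) e).card) ∧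
    (∀ e ∈ H.edgeSet,
      IsApprox ((availableColours (h.take i) e).card : ℝ) (eHat n r σ (i / m))
        (qHat r q (i / m))) ∧
    (∀ v ∈ H.vertexSet, ∀ c : Fin q,
      IsApprox ((availableEdges H (h.take i) v c).ncard : ℝ) (eHat n r σ (i / m))
        (yHat r D (i / m)))

end RandomGreedyColouring

end

/-! Heuristically, if every variable follows its trajectory up to time `t = i/m`, put `s = 1 - t`. A
colour still available at a vertex set `S` is lost at `S` in the next step with probability about
`|S| · s^(r-1) D / (|E| · s^r q) = |S| / (m s)`. Indeed about `∑ v ∈ S, |Y_{v,c}|` edges can spoil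
it, each is given that colour with probability `1 / (|E| |Q_e|)`, and `|E| q ≈ D m`. This is the
relative decay of `s^|S|` in one step. It applies to `Q_e` with `|S| = r`, and to `Y_{v,c}` with
`|S| = r - 1`. Concentration is proved by one exponential potential instead of separate martingale
inequalities. Each variable `X` with trajectory `B` and relative error `ε` contributes `exp(l(X -
(1+ε)B)) + exp(l((1-ε)B - X))`. A contribution is at least `1` as soon as `X` leaves its interval.
While all variables are close, no contribution grows in expectation (`stepMean_exp_le`): the rates
are correct up to `1 ± 3ε` (`rate_le`, `le_rate`), and `ε = κ s^(-9r)` grows fast enough to pay for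
this. The weight `l` is chosen so that `l` times the largest one-step loss is at most `κ`, which
makes second-order terms harmless. Stopping the sum of all contributions at the first failure and
giving it the value `1` there yields a supermartingale, so the failure probability is at most the
initial potential (`one_sub_potential_le`). With `κ = n^(-σ/3)` and `η = n^(-σ)`, that is at most
`2(|E| + nq) exp(-n^(σ/3)/(2r))`, which `failure_bound` compares with `m^(-w r)`. -/

noncomputable section

namespace RandomGreedyColouring

universe u v

section

/-! ### Expectations with respect to a `PMF` -/

/-- The expectation of an `ℝ≥0∞`-valued function with respect to a `PMF`. -/
def expect {β : Type*} (p : PMF β) (F : β → ENNReal) : ENNReal := ∑' b, p b * F b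

theorem expect_pure {β : Type*} (a : β) (F : β → ENNReal) : expect (PMF.pure a) F = F a := by
  classical
  unfold expect
  rw [tsum_eq_single a]
  · simp
  · intro b hb
    simp [PMF.pure_apply, hb]

theorem expect_bind {β δ : Type*} (p : PMF β) (f : β → PMF δ) (F : δ → ENNReal) :
    expect (p.bind f) F = expect p fun a => expect (f a) F := by
  unfold expect
  simp only [PMF.bind_apply, ← ENNReal.tsum_mul_right, ← ENNReal.tsum_mul_left]
  rw [ENNReal.tsum_comm]
  simp only [mul_assoc]

theorem expect_map {β δ : Type*} (p : PMF β) (f : β → δ) (F : δ → ENNReal) :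
    expect (p.map f) F = expect p fun a => F (f a) := by
  unfold PMF.map
  rw [expect_bind]
  congr 1
  funext a
  exact expect_pure _ _

theorem expect_mono {β : Type*} (p : PMF β) {F G : β → ENNReal}
    (h : ∀ b ∈ p.support, F b ≤ G b) : expect p F ≤ expect p G := by
  refine ENNReal.tsum_le_tsum fun b => ?_
  by_cases hb : p b = 0
  · simp [hb]
  · exact mul_le_mul_right (h b hb) _

theorem expect_one {β : Type*} (p : PMF β) : expect p (fun _ => 1) = 1 := by
  simp [expect, p.tsum_coe]

theorem expect_uniformOfFinset {β : Type*} (s : Finset β) (hs : s.Nonempty) (F : β → ENNReal) :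
    expect (PMF.uniformOfFinset s hs) F = ∑ b ∈ s, (s.card : ENNReal)⁻¹ * F b := by
  classical
  unfold expect
  rw [tsum_eq_sum (s := s)]
  · refine Finset.sum_congr rfl fun b hb => ?_
    rw [PMF.uniformOfFinset_apply_of_mem hs hb]
  · intro b hb
    rw [PMF.uniformOfFinset_apply_of_notMem hs hb, zero_mul]

/-- If an event fails only where `G` is at least one, its probability is at least
`1 - E[G]`. -/
theorem one_sub_le_toOuterMeasure {β : Type*} (p : PMF β) (s : Set β) (G : β → ENNReal)
    (hG : ∀ b, b ∉ s → 1 ≤ G b) {x : ℝ} (hx : 0 ≤ x) (h : expect p G ≤ ENNReal.ofReal x) :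
    1 - x ≤ (p.toOuterMeasure s).toReal := by
  classical
  have h1 : 1 ≤ p.toOuterMeasure s + expect p G := by
    rw [PMF.toOuterMeasure_apply]
    unfold expect
    rw [← ENNReal.tsum_add, ← p.tsum_coe]
    refine ENNReal.tsum_le_tsum fun b => ?_
    by_cases hb : b ∈ s
    · simp [hb]
    · simpa [hb] using mul_le_mul_right (hG b hb) (p b)
  have hfin : p.toOuterMeasure s ≠ ⊤ :=
    ne_top_of_le_ne_top ENNReal.one_ne_top <| by
      rw [PMF.toOuterMeasure_apply, ← p.tsum_coe]
      exact ENNReal.tsum_le_tsum fun b => Set.indicator_le_self _ _ _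
  have h2 : 1 ≤ p.toOuterMeasure s + ENNReal.ofReal x := h1.trans (by gcongr)
  have h3 := ENNReal.toReal_mono (by simp [hfin]) h2
  rw [ENNReal.toReal_add hfin (by simp), ENNReal.toReal_ofReal hx] at h3
  simp only [ENNReal.toReal_one] at h3
  linarith

/-! ### Histories -/

variable {α : Type u}

theorem mem_availableColours {q : ℕ} {h : History α q} {S : Set α} {c : Fin q} :
    c ∈ availableColours h S ↔ ∀ p ∈ h, (p.1 ∩ S).Nonempty → p.2 ≠ c := by
  simp [availableColours]

theorem mem_availableColours_append {q : ℕ} {h : History α q} {S e : Set α} {c c' : Fin q} :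
    c ∈ availableColours (h ++ [(e, c')]) S ↔
      c ∈ availableColours h S ∧ ((e ∩ S).Nonempty → c' ≠ c) := by
  simp only [mem_availableColours, List.forall_mem_append, List.mem_singleton, forall_eq]

theorem availableColours_nil {q : ℕ} (S : Set α) :
    availableColours ([] : History α q) S = Finset.univ := by
  ext c
  simp [mem_availableColours]

theorem availableColours_anti {q : ℕ} (h : History α q) {S T : Set α} (hST : S ⊆ T) :
    availableColours h T ⊆ availableColours h S := by
  intro c hc
  rw [mem_availableColours] at hc ⊢
  exact fun p hp hn => hc p hp (hn.mono (Set.inter_subset_inter_right _ hST))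

/-- A colour unused around `S` is unused around each `v ∈ S`, so deleting `v` from `e` does not
matter. This turns the condition defining `Y_{v,c}` into availability at the whole edge. -/
theorem mem_availableColours_diff_singleton {q : ℕ} {h : History α q} {S e : Set α} {c : Fin q}
    {v : α} (hc : c ∈ availableColours h S) (hv : v ∈ S) :
    c ∈ availableColours h (e \ {v}) → c ∈ availableColours h e := by
  intro hd
  rw [mem_availableColours] at hc hd ⊢
  rintro p hp ⟨w, hw, hwe⟩
  by_cases hwv : w = v
  · subst hwv
    exact hc p hp ⟨w, hw, hv⟩
  · exact hd p hp ⟨w, hw, hwe, hwv⟩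

variable [Finite α]

/-- The edges as a finite set. -/
def edges (H : Hypergraph α) : Finset (Set α) := H.edgeSet.toFinite.toFinset

@[simp] theorem mem_edges {H : Hypergraph α} {e : Set α} : e ∈ edges H ↔ e ∈ H.edgeSet := by
  simp [edges]

theorem expect_step (H : Hypergraph α) {q : ℕ} (h : History α q)
    (hh : H.edgeSet.Nonempty ∧ ∀ e ∈ H.edgeSet, (availableColours h e).Nonempty)
    (F : History α q → ℝ) (hF : ∀ h', 0 ≤ F h') :
    expect (step H h) (fun h' => ENNReal.ofReal (F h')) =
      ENNReal.ofReal (∑ e ∈ edges H, ∑ c ∈ availableColours h e,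
        1 / ((edges H).card * (availableColours h e).card : ℝ) * F (h ++ [(e, c)])) := by
  classical
  have : Nonempty H.edgeSet := hh.1.to_subtype
  let _ : Fintype H.edgeSet := Fintype.ofFinite _
  have hcard : Fintype.card H.edgeSet = (edges H).card := by
    rw [← Nat.card_eq_fintype_card, Nat.card_coe_set_eq, Set.ncard_eq_toFinset_card']
    congr 1
  unfold step
  rw [dif_pos hh, expect_bind]
  have key : ∀ e : H.edgeSet,
      expect ((PMF.uniformOfFinset (availableColours h e.1) (hh.2 e.1 e.2)).map
        fun c => h ++ [(e.1, c)]) (fun h' => ENNReal.ofReal (F h')) =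
      ENNReal.ofReal (∑ c ∈ availableColours h e.1,
        ((availableColours h e.1).card : ℝ)⁻¹ * F (h ++ [(e.1, c)])) := by
    intro e
    have hpos : (0 : ℝ) < (availableColours h e.1).card := by
      exact_mod_cast (hh.2 e.1 e.2).card_pos
    rw [expect_map, expect_uniformOfFinset, ENNReal.ofReal_sum_of_nonneg]
    · refine Finset.sum_congr rfl fun c _ => ?_
      rw [ENNReal.ofReal_mul (by positivity), ENNReal.ofReal_inv_of_pos hpos,
        ENNReal.ofReal_natCast]
    · intro c _
      exact mul_nonneg (by positivity) (hF _)
  simp only [key]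
  unfold expect
  rw [tsum_fintype]
  simp only [PMF.uniformOfFintype_apply]
  have hpos : (0 : ℝ) < (edges H).card := by
    rw [← hcard]
    exact_mod_cast Fintype.card_pos
  rw [hcard, ENNReal.ofReal_sum_of_nonneg]
  · rw [← Finset.sum_subtype (edges H) (fun e => mem_edges)
      (fun e => ((edges H).card : ENNReal)⁻¹ * ENNReal.ofReal (∑ c ∈ availableColours h e,
        ((availableColours h e).card : ℝ)⁻¹ * F (h ++ [(e, c)])))]
    refine Finset.sum_congr rfl fun e _ => ?_
    rw [← ENNReal.ofReal_natCast, ← ENNReal.ofReal_inv_of_pos hpos,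
      ← ENNReal.ofReal_mul (by positivity), Finset.mul_sum]
    congr 1
    refine Finset.sum_congr rfl fun c _ => ?_
    rw [one_div, mul_inv, mul_assoc]
  · intro e _
    exact Finset.sum_nonneg fun c _ => mul_nonneg (by positivity) (hF _)

theorem eq_of_mem_support_step {H : Hypergraph α} {q : ℕ} {h h' : History α q}
    (hs : h' ∈ (step H h).support) : h' = h ∨ ∃ e c, h' = h ++ [(e, c)] := by
  unfold step at hs
  split_ifs at hs with hh
  · simp only [PMF.mem_support_bind_iff, PMF.mem_support_map_iff] at hs
    obtain ⟨e, -, c, -, rfl⟩ := hs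
    exact Or.inr ⟨_, _, rfl⟩
  · left
    simpa using hs

theorem exists_of_mem_support_step {H : Hypergraph α} {q : ℕ} {h h' : History α q}
    (hh : H.edgeSet.Nonempty ∧ ∀ e ∈ H.edgeSet, (availableColours h e).Nonempty)
    (hs : h' ∈ (step H h).support) : ∃ e c, h' = h ++ [(e, c)] := by
  unfold step at hs
  rw [dif_pos hh] at hs
  simp only [PMF.mem_support_bind_iff, PMF.mem_support_map_iff] at hs
  obtain ⟨e, -, c, -, rfl⟩ := hs
  exact ⟨_, _, rfl⟩

theorem length_le_of_mem_support_law {H : Hypergraph α} {q : ℕ} (i : ℕ) {h : History α q}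
    (hs : h ∈ (law H q i).support) : h.length ≤ i := by
  induction i generalizing h with
  | zero => simp [law] at hs; simp [hs]
  | succ i ih =>
    simp only [law, PMF.mem_support_bind_iff] at hs
    obtain ⟨h₀, h1, h2⟩ := hs
    have := ih h1
    rcases eq_of_mem_support_step h2 with rfl | ⟨e, c, rfl⟩
    · omega
    · simp; omega

end

section

/-! ### The deterministic trajectories -/

/-- The exponent `9r` exceeds the decay exponent `p` by at least `8p`, so even the absolute error
width grows by a factor `1 + 8px` per step. This is the slack that absorbs all errors in the
transition rates. Here `x = 1/(ms)` is the relative decrease of `s` in one step. -/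
theorem error_growth {p r : ℕ} (hp : p ≤ r) {x ε : ℝ} (hx0 : 0 ≤ x) (hx1 : x < 1) (hε : 0 ≤ ε) :
    ε * (1 + 8 * (p * x)) ≤ (1 - x) ^ p * (ε / (1 - x) ^ (9 * r)) := by
  obtain ⟨k, hk⟩ : ∃ k, 9 * r = p + k := ⟨9 * r - p, by omega⟩
  have h1 : 0 < 1 - x := by linarith
  have hk8 : (8 * p : ℝ) ≤ k := by exact_mod_cast (by omega : 8 * p ≤ k)
  have e1 : (1 - x) ^ p * (ε / (1 - x) ^ (9 * r)) = ε / (1 - x) ^ k := by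
    rw [hk, pow_add]
    field_simp
  rw [e1, le_div_iff₀ (by positivity), mul_assoc]
  refine mul_le_of_le_one_right hε ?_
  have h2 : 1 + 8 * (p * x) ≤ (1 + x) ^ k := by
    refine le_trans ?_ (one_add_mul_le_pow (by linarith) k)
    nlinarith
  calc (1 + 8 * (p * x)) * (1 - x) ^ k ≤ (1 + x) ^ k * (1 - x) ^ k := by gcongr
    _ = (1 - x ^ 2) ^ k := by rw [← mul_pow]; ring
    _ ≤ 1 := pow_le_one₀ (by nlinarith) (by nlinarith)

theorem upper_decrement_le {p r : ℕ} (hp : p ≤ r) {x ε : ℝ} (hx0 : 0 ≤ x) (hx1 : x < 1)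
    (hε : 0 ≤ ε) :
    (1 + ε) - (1 - x) ^ p * (1 + ε / (1 - x) ^ (9 * r)) ≤ p * x * (1 - 8 * ε) := by
  have h1 := error_growth hp hx0 hx1 hε
  have h2 : 1 + p * (-x) ≤ (1 + -x) ^ p := one_add_mul_le_pow (by linarith) p
  rw [← sub_eq_add_neg] at h2
  linarith

theorem le_lower_decrement {p r : ℕ} (hp : p ≤ r) {x ε : ℝ} (hx0 : 0 ≤ x) (hx1 : x < 1)
    (hε : 0 ≤ ε) :
    p * x * (1 - p * x + 8 * ε) ≤ (1 - ε) - (1 - x) ^ p * (1 - ε / (1 - x) ^ (9 * r)) := by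
  have h1 := error_growth hp hx0 hx1 hε
  have hpx : (0 : ℝ) ≤ p * x := by positivity
  have h2 : (1 - x) ^ p ≤ 1 - p * x + (p * x) ^ 2 := by
    have h3 : 1 + p * x ≤ (1 + x) ^ p := one_add_mul_le_pow (by linarith) p
    have h4 : (1 - x) ^ p * (1 + p * x) ≤ 1 := by
      calc (1 - x) ^ p * (1 + p * x) ≤ (1 - x) ^ p * (1 + x) ^ p := by
            gcongr
        _ = (1 - x ^ 2) ^ p := by rw [← mul_pow]; ring
        _ ≤ 1 := pow_le_one₀ (by nlinarith) (by nlinarith)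
    have h5 : (1 - x) ^ p ≤ 1 / (1 + p * x) := by rwa [le_div_iff₀ (by positivity)]
    refine h5.trans ?_
    rw [div_le_iff₀ (by positivity)]
    nlinarith [pow_nonneg hpx 3]
  linarith

/-! ### Exponential moments of bounded losses -/

section Moments

variable {β : Type*} {T : Finset β} {w L : β → ℝ} {l M μ : ℝ}

/-- Since `exp(-y) ≤ 1 - y + y²` for `0 ≤ y ≤ 1`, and `y² ≤ lM · y` for `y = lL`, the quadratic term
only costs a factor `1 - lM` on the mean. -/
theorem sum_exp_neg_le (hw : ∀ b ∈ T, 0 ≤ w b) (hw1 : ∑ b ∈ T, w b = 1)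
    (hL : ∀ b ∈ T, 0 ≤ L b ∧ L b ≤ M) (hl : 0 ≤ l) (hlM : l * M ≤ 1)
    (hμ : ∑ b ∈ T, w b * L b = μ) :
    ∑ b ∈ T, w b * Real.exp (-(l * L b)) ≤ Real.exp (-(l * (μ * (1 - l * M)))) := by
  have h1 : ∀ b ∈ T, w b * Real.exp (-(l * L b)) ≤ w b - w b * L b * (l * (1 - l * M)) := by
    intro b hb
    have h0 : 0 ≤ l * L b := mul_nonneg hl (hL b hb).1
    have h2 : l * L b ≤ l * M := mul_le_mul_of_nonneg_left (hL b hb).2 hl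
    have h3 := Real.abs_exp_sub_one_sub_id_le (x := -(l * L b))
      (by rw [abs_neg, abs_of_nonneg h0]; linarith)
    have h4 : Real.exp (-(l * L b)) ≤ 1 - l * L b * (1 - l * M) := by
      nlinarith [(abs_le.1 h3).2]
    calc w b * Real.exp (-(l * L b)) ≤ w b * (1 - l * L b * (1 - l * M)) :=
          mul_le_mul_of_nonneg_left h4 (hw b hb)
      _ = _ := by ring
  refine (Finset.sum_le_sum h1).trans ?_
  rw [Finset.sum_sub_distrib, hw1, ← Finset.sum_mul, hμ]
  have := Real.add_one_le_exp (-(l * (μ * (1 - l * M))))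
  linarith

theorem sum_exp_le (hw : ∀ b ∈ T, 0 ≤ w b) (hw1 : ∑ b ∈ T, w b = 1)
    (hL : ∀ b ∈ T, 0 ≤ L b ∧ L b ≤ M) (hl : 0 ≤ l) (hlM : l * M ≤ 1)
    (hμ : ∑ b ∈ T, w b * L b = μ) :
    ∑ b ∈ T, w b * Real.exp (l * L b) ≤ Real.exp (l * (μ * (1 + l * M))) := by
  have h1 : ∀ b ∈ T, w b * Real.exp (l * L b) ≤ w b + w b * L b * (l * (1 + l * M)) := by
    intro b hb
    have h0 : 0 ≤ l * L b := mul_nonneg hl (hL b hb).1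
    have h2 : l * L b ≤ l * M := mul_le_mul_of_nonneg_left (hL b hb).2 hl
    have h3 := Real.abs_exp_sub_one_sub_id_le (x := l * L b)
      (by rw [abs_of_nonneg h0]; linarith)
    have h4 : Real.exp (l * L b) ≤ 1 + l * L b * (1 + l * M) := by
      nlinarith [(abs_le.1 h3).2]
    calc w b * Real.exp (l * L b) ≤ w b * (1 + l * L b * (1 + l * M)) :=
          mul_le_mul_of_nonneg_left h4 (hw b hb)
      _ = _ := by ring
  refine (Finset.sum_le_sum h1).trans ?_
  rw [Finset.sum_add_distrib, hw1, ← Finset.sum_mul, hμ]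
  have := Real.add_one_le_exp (l * (μ * (1 + l * M)))
  linarith

variable {X B ε u κ U : ℝ}

/-- One step of the supermartingale for the upper deviation. -/
theorem sum_exp_upper_le (hw : ∀ b ∈ T, 0 ≤ w b) (hw1 : ∑ b ∈ T, w b = 1)
    (hL : ∀ b ∈ T, 0 ≤ L b ∧ L b ≤ M) (hl : 0 ≤ l) (hlM : l * M ≤ κ) (hκε : κ ≤ ε)
    (hε0 : 0 ≤ ε) (hε : ε ≤ 1 / 100) (hB : 0 ≤ B) (hX : (1 - ε) * B ≤ X) (hu : 0 ≤ u)
    (hμ : X * (u * (1 - 3 * ε)) ≤ ∑ b ∈ T, w b * L b)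
    (hU : (1 + ε) * B - U ≤ B * (u * (1 - 8 * ε))) :
    ∑ b ∈ T, w b * Real.exp (l * (X - L b - U)) ≤ Real.exp (l * (X - (1 + ε) * B)) := by
  have h1 : ∀ b, w b * Real.exp (l * (X - L b - U)) =
      Real.exp (l * (X - U)) * (w b * Real.exp (-(l * L b))) := by
    intro b
    rw [mul_left_comm, ← Real.exp_add]
    ring_nf
  simp only [h1]
  rw [← Finset.mul_sum]
  have h2 := sum_exp_neg_le hw hw1 hL hl (by linarith) rfl
  refine (mul_le_mul_of_nonneg_left h2 (Real.exp_pos _).le).trans ?_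
  rw [← Real.exp_add, Real.exp_le_exp, ← sub_eq_add_neg, ← mul_sub]
  refine mul_le_mul_of_nonneg_left ?_ hl
  set μ := ∑ b ∈ T, w b * L b
  have hBu : 0 ≤ B * u := by positivity
  have h3 : (1 - ε) * B * (u * (1 - 3 * ε)) ≤ μ :=
    (mul_le_mul_of_nonneg_right hX (mul_nonneg hu (by linarith))).trans hμ
  have h4 : (1 - ε) * B * (u * (1 - 3 * ε)) * (1 - ε) ≤ μ * (1 - l * M) := by
    have hpos : 0 ≤ (1 - ε) * B * (u * (1 - 3 * ε)) :=
      mul_nonneg (mul_nonneg (by linarith) hB) (mul_nonneg hu (by linarith))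
    exact mul_le_mul h3 (by linarith) (by linarith) (hpos.trans h3)
  -- The three factors are the deviation of `X`, the error of the rate and the second-order term;
  -- together they cost about `5ε`, within the available `8ε`.
  have h5 : B * (u * (1 - 8 * ε)) ≤ (1 - ε) * B * (u * (1 - 3 * ε)) * (1 - ε) := by
    have : (1 - 8 * ε) ≤ (1 - ε) * (1 - 3 * ε) * (1 - ε) := by
      nlinarith [mul_nonneg hε0 hε0, mul_nonneg (mul_nonneg hε0 hε0) (sub_nonneg.2 hε)]
    calc _ = B * u * (1 - 8 * ε) := by ring
      _ ≤ B * u * ((1 - ε) * (1 - 3 * ε) * (1 - ε)) := mul_le_mul_of_nonneg_left this hBu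
      _ = _ := by ring
  linarith

/-- One step of the supermartingale for the lower deviation. -/
theorem sum_exp_lower_le (hw : ∀ b ∈ T, 0 ≤ w b) (hw1 : ∑ b ∈ T, w b = 1)
    (hL : ∀ b ∈ T, 0 ≤ L b ∧ L b ≤ M) (hl : 0 ≤ l) (hlM : l * M ≤ κ) (hκε : κ ≤ ε)
    (hε0 : 0 ≤ ε) (hε : ε ≤ 1 / 100) (hB : 0 ≤ B) (hX : X ≤ (1 + ε) * B) (hu : 0 ≤ u)
    (huε : u ≤ ε)
    (hμ : ∑ b ∈ T, w b * L b ≤ X * (u * (1 + 3 * ε)))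
    (hU : B * (u * (1 - u + 8 * ε)) ≤ (1 - ε) * B - U) :
    ∑ b ∈ T, w b * Real.exp (l * (U - (X - L b))) ≤ Real.exp (l * ((1 - ε) * B - X)) := by
  have h1 : ∀ b, w b * Real.exp (l * (U - (X - L b))) =
      Real.exp (l * (U - X)) * (w b * Real.exp (l * L b)) := by
    intro b
    rw [mul_left_comm, ← Real.exp_add]
    ring_nf
  simp only [h1]
  rw [← Finset.mul_sum]
  have h2 := sum_exp_le hw hw1 hL hl (by linarith) rfl
  refine (mul_le_mul_of_nonneg_left h2 (Real.exp_pos _).le).trans ?_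
  rw [← Real.exp_add, Real.exp_le_exp, ← mul_add]
  refine mul_le_mul_of_nonneg_left ?_ hl
  set μ := ∑ b ∈ T, w b * L b with hμdef
  have hμ0 : 0 ≤ μ := Finset.sum_nonneg fun b hb => mul_nonneg (hw b hb) (hL b hb).1
  have hBu : 0 ≤ B * u := by positivity
  have h3 : μ ≤ (1 + ε) * B * (u * (1 + 3 * ε)) :=
    hμ.trans (mul_le_mul_of_nonneg_right hX (by positivity))
  have h4 : μ * (1 + l * M) ≤ (1 + ε) * B * (u * (1 + 3 * ε)) * (1 + ε) :=
    (mul_le_mul_of_nonneg_left (by linarith) hμ0).trans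
      (mul_le_mul_of_nonneg_right h3 (by linarith))
  -- Again about `5ε` is spent; the discretisation loss `u ≤ ε` also fits into `8ε`.
  have h5 : (1 + ε) * B * (u * (1 + 3 * ε)) * (1 + ε) ≤ B * (u * (1 - u + 8 * ε)) := by
    have : (1 + ε) * (1 + 3 * ε) * (1 + ε) ≤ 1 - u + 8 * ε := by
      nlinarith [mul_nonneg hε0 hε0, mul_nonneg hε0 (sub_nonneg.2 hε),
        mul_nonneg (mul_nonneg hε0 hε0) (sub_nonneg.2 hε)]
    calc _ = B * u * ((1 + ε) * (1 + 3 * ε) * (1 + ε)) := by ring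
      _ ≤ B * u * (1 - u + 8 * ε) := mul_le_mul_of_nonneg_left this hBu
      _ = _ := by ring
  linarith

end Moments

end

/-! ### Quasirandomness hypotheses and transition rates -/

section

variable {α : Type u}

/-- The quasirandomness hypotheses on the hypergraph, together with the relations between the
parameters: `κ` is the initial relative error, `η` the relative irregularity of `H`. -/
structure Regular (H : Hypergraph α) (n r q : ℕ) (κ η γ m D : ℝ) : Prop where
  uniform : IsUniform H r
  card_vertices : H.vertexSet.ncard = n
  le_degree : ∀ v ∈ H.vertexSet, (1 - η) * D ≤ degree H v
  degree_le : ∀ v ∈ H.vertexSet, (degree H v : ℝ) ≤ (1 + η) * D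
  codegree_le : ∀ x ∈ H.vertexSet, ∀ y ∈ H.vertexSet, x ≠ y → (codegree H x y : ℝ) ≤ η * D
  n_pos : 0 < n
  one_lt_r : 1 < r
  D_pos : 0 < D
  m_pos : 0 < m
  κ_pos : 0 < κ
  η_pos : 0 < η
  γ_pos : 0 < γ
  γ_lt_one : γ < 1
  r_mul_η_le : r * η ≤ κ / 100
  error_le : κ / γ ^ (9 * r) ≤ 1 / 100
  n_div_m_le : n / m ≤ η
  le_q : (1 - η) * (r * m / n) ≤ q
  q_le : q ≤ r * m / n

namespace Regular

variable {H : Hypergraph α} {n r q : ℕ} {κ η γ m D : ℝ}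

theorem η_le (R : Regular H n r q κ η γ m D) : η ≤ κ / 100 := by
  have h1 : (1 : ℝ) ≤ r := by exact_mod_cast R.one_lt_r.le
  nlinarith [R.r_mul_η_le, R.η_pos]

theorem error_pos (R : Regular H n r q κ η γ m D) {s : ℝ} (hs : γ ≤ s) :
    0 < κ / s ^ (9 * r) :=
  div_pos R.κ_pos (pow_pos (R.γ_pos.trans_le hs) _)

theorem error_le' (R : Regular H n r q κ η γ m D) {s : ℝ} (hs : γ ≤ s) :
    κ / s ^ (9 * r) ≤ 1 / 100 := by
  refine le_trans ?_ R.error_le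
  have := R.γ_pos
  have := R.κ_pos
  gcongr

/-- Errors of order `κ` relative to the initial values stay below `ε` relative to trajectories that
have shrunk by `s^k`, because `ε` carries the factor `s^(-9r)`. -/
theorem κ_le_error_mul (R : Regular H n r q κ η γ m D) {s : ℝ} (hs : γ ≤ s) (hs1 : s ≤ 1)
    {k : ℕ} (hk : k ≤ 9 * r) : κ ≤ κ / s ^ (9 * r) * s ^ k := by
  have hs0 := R.γ_pos.trans_le hs
  rw [div_mul_eq_mul_div, le_div_iff₀ (by positivity)]
  exact mul_le_mul_of_nonneg_left (pow_le_pow_of_le_one hs0.le hs1 hk) R.κ_pos.le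

theorem κ_le_error (R : Regular H n r q κ η γ m D) {s : ℝ} (hs : γ ≤ s) (hs1 : s ≤ 1) :
    κ ≤ κ / s ^ (9 * r) := by
  simpa using R.κ_le_error_mul hs hs1 (k := 0) (by omega)

theorem κ_le (R : Regular H n r q κ η γ m D) : κ ≤ 1 / 100 :=
  (R.κ_le_error R.γ_lt_one.le le_rfl).trans (R.error_le' R.γ_lt_one.le)

theorem r_pos (R : Regular H n r q κ η γ m D) : (0 : ℝ) < r := by
  exact_mod_cast (by have := R.one_lt_r; omega : 0 < r)

theorem n_pos' (R : Regular H n r q κ η γ m D) : (0 : ℝ) < n := by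
  exact_mod_cast R.n_pos

theorem inv_m_le (R : Regular H n r q κ η γ m D) : 1 / m ≤ η := by
  refine le_trans ?_ R.n_div_m_le
  have := R.m_pos
  have h1 : (1 : ℝ) ≤ n := by exact_mod_cast R.n_pos
  gcongr

theorem q_pos (R : Regular H n r q κ η γ m D) : (0 : ℝ) < q := by
  have h1 := R.r_pos
  have h2 := R.n_pos'
  have h3 := R.m_pos
  have h4 := R.η_le
  have h5 := R.κ_le
  exact lt_of_lt_of_le (mul_pos (by linarith) (by positivity)) R.le_q

end Regular

variable [Finite α]

/-! ### Degrees and the one-step transition rates -/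

open Classical in
theorem degree_eq_card (H : Hypergraph α) (v : α) :
    degree H v = ((edges H).filter (v ∈ ·)).card := by
  unfold degree
  rw [← Set.ncard_coe_finset]
  congr 1
  ext e
  simp

open Classical in
theorem codegree_eq_card (H : Hypergraph α) (x y : α) :
    codegree H x y = ((edges H).filter fun e => x ∈ e ∧ y ∈ e).card := by
  unfold codegree
  rw [← Set.ncard_coe_finset]
  congr 1
  ext e
  simp [Set.insert_subset_iff]

open Classical in
/-- The set `Y_{v,c}` as a finite set. -/
def availableEdgesFinset (H : Hypergraph α) {q : ℕ} (h : History α q) (v : α) (c : Fin q) :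
    Finset (Set α) :=
  ((edges H).filter (v ∈ ·)).filter fun f => c ∈ availableColours h (f \ {v})

theorem ncard_availableEdges (H : Hypergraph α) {q : ℕ} (h : History α q) (v : α) (c : Fin q) :
    (availableEdges H h v c).ncard = (availableEdgesFinset H h v c).card := by
  rw [← Set.ncard_coe_finset]
  congr 1
  ext e
  simp [availableEdges, availableEdgesFinset, and_assoc]

open Classical in
/-- The edges meeting `S` at which the colour `c` is available. -/
def hitEdges (H : Hypergraph α) {q : ℕ} (h : History α q) (S : Set α) (c : Fin q) :
    Finset (Set α) :=
  (edges H).filter fun e => (e ∩ S).Nonempty ∧ c ∈ availableColours h e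

theorem mem_edgeSet_of_mem_hitEdges {H : Hypergraph α} {q : ℕ} {h : History α q} {S : Set α}
    {c : Fin q} {e : Set α} (he : e ∈ hitEdges H h S c) : e ∈ H.edgeSet := by
  classical
  exact mem_edges.1 (Finset.mem_filter.1 he).1

section Counting

variable {H : Hypergraph α} {q : ℕ} {h : History α q} {S : Finset α} {c : Fin q}

-- Double counting of pairs `(v, e)` with `v ∈ S ∩ e`: as `c` is available at `S`, an edge through
-- `v ∈ S` lies in `Y_{v,c}` exactly when `c` is available at the whole edge.
open Classical in
theorem sum_availableEdges_eq (hc : c ∈ availableColours h (S : Set α)) :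
    ∑ v ∈ S, (availableEdgesFinset H h v c).card =
      ∑ e ∈ hitEdges H h S c, (S.filter (· ∈ e)).card := by
  have h1 : ∀ v ∈ S, availableEdgesFinset H h v c =
      (hitEdges H h S c).filter (v ∈ ·) := by
    intro v hv
    ext e
    simp only [availableEdgesFinset, hitEdges, Finset.mem_filter, mem_edges]
    constructor
    · rintro ⟨⟨he, hve⟩, hd⟩
      exact ⟨⟨he, ⟨v, hve, hv⟩, mem_availableColours_diff_singleton hc hv hd⟩, hve⟩
    · rintro ⟨⟨he, -, hce⟩, hve⟩
      exact ⟨⟨he, hve⟩, availableColours_anti h Set.sdiff_subset hce⟩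
  rw [Finset.sum_congr rfl fun v hv => by rw [h1 v hv]]
  exact Finset.sum_card_bipartiteAbove_eq_sum_card_bipartiteBelow (fun v e => v ∈ e)

theorem card_hitEdges_le (hc : c ∈ availableColours h (S : Set α)) :
    (hitEdges H h S c).card ≤ ∑ v ∈ S, (availableEdgesFinset H h v c).card := by
  classical
  rw [sum_availableEdges_eq hc, Finset.card_eq_sum_ones]
  refine Finset.sum_le_sum fun e he => ?_
  simp only [hitEdges, Finset.mem_filter] at he
  obtain ⟨v, hve, hvS⟩ := he.2.1
  exact Finset.card_pos.2 ⟨v, by simpa using ⟨hvS, hve⟩⟩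

/-- An edge meeting `S` in `k ≥ 1` vertices is counted `k ≤ 1 + k(k-1)` times, and the `k(k-1)`
ordered pairs are charged to codegrees. -/
theorem sum_availableEdges_le (hc : c ∈ availableColours h (S : Set α)) :
    ∑ v ∈ S, (availableEdgesFinset H h v c).card ≤
      (hitEdges H h S c).card + ∑ z ∈ S.offDiag, codegree H z.1 z.2 := by
  classical
  rw [sum_availableEdges_eq hc]
  have h1 : ∑ z ∈ S.offDiag, codegree H z.1 z.2 =
      ∑ e ∈ edges H, (S.offDiag.filter fun z => z.1 ∈ e ∧ z.2 ∈ e).card := by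
    simp only [codegree_eq_card]
    exact Finset.sum_card_bipartiteAbove_eq_sum_card_bipartiteBelow
      (fun (z : α × α) (e : Set α) => z.1 ∈ e ∧ z.2 ∈ e)
  have h2 : ∑ e ∈ hitEdges H h S c, (S.offDiag.filter fun z => z.1 ∈ e ∧ z.2 ∈ e).card ≤
      ∑ e ∈ edges H, (S.offDiag.filter fun z => z.1 ∈ e ∧ z.2 ∈ e).card :=
    Finset.sum_le_sum_of_subset (Finset.filter_subset _ _)
  rw [h1]
  refine le_trans ?_ (Nat.add_le_add_left h2 _)
  rw [Finset.card_eq_sum_ones, ← Finset.sum_add_distrib]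
  refine Finset.sum_le_sum fun e _ => ?_
  have h3 : (S.offDiag.filter fun z => z.1 ∈ e ∧ z.2 ∈ e) = (S.filter (· ∈ e)).offDiag := by
    ext z
    simp only [Finset.mem_filter, Finset.mem_offDiag]
    tauto
  rw [h3, Finset.offDiag_card]
  generalize (S.filter (· ∈ e)).card = k
  rcases k with _ | _ | k
  · omega
  · omega
  · have : (k + 1 + 1) * (k + 1 + 1) = (k + 1) * (k + 1 + 1) + (k + 1 + 1) := by ring
    rw [this, Nat.add_sub_cancel]
    nlinarith

end Counting

/-- All the variables `|Q_e|` and `|Y_{v,c}|` are within the relative error `κ / s ^ (9 r)` of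
their trajectories, where `s` stands for `1 - t`. -/
def Close (H : Hypergraph α) (r : ℕ) (κ D s : ℝ) {q : ℕ} (h : History α q) : Prop :=
  (∀ e ∈ H.edgeSet,
    IsApprox ((availableColours h e).card : ℝ) (κ / s ^ (9 * r)) (s ^ r * q)) ∧
  (∀ v ∈ H.vertexSet, ∀ c : Fin q,
    IsApprox ((availableEdgesFinset H h v c).card : ℝ) (κ / s ^ (9 * r)) (s ^ (r - 1) * D))

namespace Regular

variable {H : Hypergraph α} {n r q : ℕ} {κ η γ m D : ℝ}

theorem sum_degree (R : Regular H n r q κ η γ m D) :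
    ∑ v ∈ H.vertexSet.toFinite.toFinset, degree H v = r * (edges H).card := by
  classical
  simp only [degree_eq_card]
  have h1 := Finset.sum_card_bipartiteAbove_eq_sum_card_bipartiteBelow
    (s := H.vertexSet.toFinite.toFinset) (t := edges H) (fun v e => v ∈ e)
  refine h1.trans ?_
  rw [mul_comm, ← smul_eq_mul]
  refine Finset.sum_const_nat fun e he => ?_
  rw [mem_edges] at he
  rw [← (R.uniform e he).2, ← Set.ncard_coe_finset]
  congr 1
  ext v
  simp only [Finset.bipartiteBelow, Finset.coe_filter, Set.Finite.mem_toFinset, Set.mem_ofPred_eq]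
  exact ⟨fun hv => hv.2, fun hv => ⟨H.subset_vertexSet_of_mem_edgeSet he hv, hv⟩⟩

theorem card_vertices' (R : Regular H n r q κ η γ m D) :
    (H.vertexSet.toFinite.toFinset).card = n := by
  rw [← R.card_vertices, Set.ncard_eq_toFinset_card]

theorem le_card_edges (R : Regular H n r q κ η γ m D) :
    (1 - η) * (n * D / r) ≤ (edges H).card := by
  have h1 : ∑ v ∈ H.vertexSet.toFinite.toFinset, (1 - η) * D ≤
      ∑ v ∈ H.vertexSet.toFinite.toFinset, (degree H v : ℝ) :=
    Finset.sum_le_sum fun v hv => R.le_degree v (by simpa using hv)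
  rw [← Nat.cast_sum, R.sum_degree, Finset.sum_const, R.card_vertices', nsmul_eq_mul] at h1
  push_cast at h1
  have h2 : (1 - η) * (n * D / r) = n * ((1 - η) * D) / r := by ring
  rw [h2, div_le_iff₀ R.r_pos]
  linarith

theorem card_edges_le (R : Regular H n r q κ η γ m D) :
    (edges H).card ≤ (1 + η) * (n * D / r) := by
  have h1 : ∑ v ∈ H.vertexSet.toFinite.toFinset, (degree H v : ℝ) ≤
      ∑ v ∈ H.vertexSet.toFinite.toFinset, (1 + η) * D :=
    Finset.sum_le_sum fun v hv => R.degree_le v (by simpa using hv)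
  rw [← Nat.cast_sum, R.sum_degree, Finset.sum_const, R.card_vertices', nsmul_eq_mul] at h1
  push_cast at h1
  have h2 : (1 + η) * (n * D / r) = n * ((1 + η) * D) / r := by ring
  rw [h2, le_div_iff₀ R.r_pos]
  linarith

theorem card_edges_pos (R : Regular H n r q κ η γ m D) : (0 : ℝ) < (edges H).card := by
  have h1 := R.r_pos
  have h2 := R.n_pos'
  have h3 := R.D_pos
  have h4 := R.η_le
  have h5 := R.κ_le
  exact lt_of_lt_of_le (mul_pos (by linarith) (by positivity)) R.le_card_edges

theorem le_card_edges_mul_q (R : Regular H n r q κ η γ m D) :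
    (1 - η) ^ 2 * (D * m) ≤ (edges H).card * q := by
  have h1 := R.r_pos
  have h2 := R.n_pos'
  have h3 := R.D_pos
  have h4 := R.η_le
  have h5 := R.κ_le
  have h6 := R.m_pos
  have h7 : 0 ≤ 1 - η := by linarith
  calc (1 - η) ^ 2 * (D * m) = (1 - η) * (n * D / r) * ((1 - η) * (r * m / n)) := by
        field_simp
    _ ≤ _ := mul_le_mul R.le_card_edges R.le_q (by positivity) (by positivity)

theorem card_edges_mul_q_le (R : Regular H n r q κ η γ m D) :
    (edges H).card * q ≤ (1 + η) * (D * m) := by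
  have h1 := R.r_pos
  have h2 := R.n_pos'
  have h3 := R.D_pos
  have h4 := R.η_pos
  have h6 := R.m_pos
  calc ((edges H).card * q : ℝ) ≤ (1 + η) * (n * D / r) * (r * m / n) :=
        mul_le_mul R.card_edges_le R.q_le (by positivity) (by positivity)
    _ = _ := by field_simp

variable {s : ℝ} {h : History α q} {S : Finset α} {c : Fin q}

/-- The probability that the next step colours an edge meeting `S` with `c`. -/
theorem rate_le (R : Regular H n r q κ η γ m D) (hs : γ ≤ s) (hs1 : s ≤ 1)
    (hC : Close H r κ D s h) (hS : (S : Set α) ⊆ H.vertexSet)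
    (hc : c ∈ availableColours h (S : Set α)) :
    ∑ e ∈ hitEdges H h S c, 1 / ((edges H).card * (availableColours h e).card : ℝ) ≤
      S.card * (1 / (m * s)) * (1 + 3 * (κ / s ^ (9 * r))) := by
  have hs0 := R.γ_pos.trans_le hs
  have hε0 := R.error_pos hs
  have hε1 := R.error_le' hs
  have hκε := R.κ_le_error hs hs1
  have hη := R.η_le
  have hη0 := R.η_pos
  have hD := R.D_pos
  have hm := R.m_pos
  have hE := R.card_edges_pos
  have hq := R.q_pos
  have hEq := R.le_card_edges_mul_q
  obtain ⟨k, rfl⟩ : ∃ k, r = k + 1 := ⟨r - 1, by have := R.one_lt_r; omega⟩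
  set ε := κ / s ^ (9 * (k + 1)) with hεdef
  have h1 : ((hitEdges H h S c).card : ℝ) ≤ S.card * ((1 + ε) * (s ^ k * D)) := by
    have h2 : ((hitEdges H h S c).card : ℝ) ≤
        ∑ v ∈ S, ((availableEdgesFinset H h v c).card : ℝ) := by
      exact_mod_cast card_hitEdges_le hc
    refine h2.trans ?_
    rw [← nsmul_eq_mul]
    exact Finset.sum_le_card_nsmul _ _ _ fun v hv => by
      simpa using (hC.2 v (hS hv) c).2
  have hden : 0 < (edges H).card * ((1 - ε) * (s ^ (k + 1) * q)) :=
    mul_pos hE (mul_pos (by linarith) (by positivity))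
  have h3 : ∀ e ∈ hitEdges H h S c, 1 / ((edges H).card * (availableColours h e).card : ℝ) ≤
      1 / ((edges H).card * ((1 - ε) * (s ^ (k + 1) * q))) := by
    intro e he
    refine one_div_le_one_div_of_le hden ?_
    refine mul_le_mul_of_nonneg_left ?_ hE.le
    exact (hC.1 e (mem_edgeSet_of_mem_hitEdges he)).1
  refine (Finset.sum_le_card_nsmul _ _ _ h3).trans ?_
  rw [nsmul_eq_mul, mul_one_div, div_le_iff₀ hden]
  refine h1.trans ?_
  -- One `ε` each comes from the numbers of edges and of colours; the irregularity satisfies `η ≤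
  -- κ/100 ≤ ε/100`, so `3ε` suffices.
  have h4 : 1 + ε ≤ (1 + 3 * ε) * (1 - ε) * (1 - η) ^ 2 := by
    have ha : 1 - 2 * (ε / 100) ≤ (1 - η) ^ 2 := by nlinarith
    have hb : 1 + ε ≤ (1 + 3 * ε) * (1 - ε) * (1 - 2 * (ε / 100)) := by
      nlinarith [mul_nonneg hε0.le (sub_nonneg.2 hε1), pow_pos hε0 3]
    exact hb.trans (mul_le_mul_of_nonneg_left ha (mul_nonneg (by linarith) (by linarith)))
  have h5 : (1 + ε) * (D * m) ≤ (1 + 3 * ε) * (1 - ε) * ((edges H).card * q) :=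
    calc (1 + ε) * (D * m) ≤ (1 + 3 * ε) * (1 - ε) * (1 - η) ^ 2 * (D * m) := by gcongr
      _ = (1 + 3 * ε) * (1 - ε) * ((1 - η) ^ 2 * (D * m)) := by ring
      _ ≤ _ := mul_le_mul_of_nonneg_left hEq (mul_nonneg (by linarith) (by linarith))
  calc S.card * ((1 + ε) * (s ^ k * D)) = S.card * s ^ k / m * ((1 + ε) * (D * m)) := by
        field_simp
    _ ≤ S.card * s ^ k / m * ((1 + 3 * ε) * (1 - ε) * ((edges H).card * q)) := by gcongr
    _ = _ := by
        rw [pow_succ]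
        field_simp

theorem le_rate (R : Regular H n r q κ η γ m D) (hs : γ ≤ s) (hs1 : s ≤ 1)
    (hC : Close H r κ D s h) (hS : (S : Set α) ⊆ H.vertexSet) (hSr : S.card ≤ r)
    (hc : c ∈ availableColours h (S : Set α)) :
    S.card * (1 / (m * s)) * (1 - 3 * (κ / s ^ (9 * r))) ≤
      ∑ e ∈ hitEdges H h S c, 1 / ((edges H).card * (availableColours h e).card : ℝ) := by
  have hs0 := R.γ_pos.trans_le hs
  have hε0 := R.error_pos hs
  have hε1 := R.error_le' hs
  have hκε := R.κ_le_error hs hs1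
  have hη := R.η_le
  have hη0 := R.η_pos
  have hD := R.D_pos
  have hm := R.m_pos
  have hE := R.card_edges_pos
  have hq := R.q_pos
  have hEq := R.card_edges_mul_q_le
  obtain ⟨k, rfl⟩ : ∃ k, r = k + 1 := ⟨r - 1, by have := R.one_lt_r; omega⟩
  have hκk := R.κ_le_error_mul hs hs1 (k := k) (by omega)
  set ε := κ / s ^ (9 * (k + 1)) with hεdef
  have h1 : S.card * ((1 - ε - ε / 100) * (s ^ k * D)) ≤ ((hitEdges H h S c).card : ℝ) := by
    have h2 : ∑ v ∈ S, ((availableEdgesFinset H h v c).card : ℝ) ≤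
        (hitEdges H h S c).card + ∑ z ∈ S.offDiag, (codegree H z.1 z.2 : ℝ) := by
      exact_mod_cast sum_availableEdges_le hc
    have h3 : S.card * ((1 - ε) * (s ^ k * D)) ≤
        ∑ v ∈ S, ((availableEdgesFinset H h v c).card : ℝ) := by
      rw [← nsmul_eq_mul]
      exact Finset.card_nsmul_le_sum _ _ _ fun v hv => by
        simpa using (hC.2 v (hS hv) c).1
    have h4 : ∑ z ∈ S.offDiag, (codegree H z.1 z.2 : ℝ) ≤ S.offDiag.card * (η * D) := by
      rw [← nsmul_eq_mul]
      refine Finset.sum_le_card_nsmul _ _ _ fun z hz => ?_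
      rw [Finset.mem_offDiag] at hz
      exact R.codegree_le _ (hS hz.1) _ (hS hz.2.1) hz.2.2
    have h5 : (S.offDiag.card : ℝ) ≤ S.card * (k + 1 : ℕ) := by
      have : S.offDiag.card ≤ S.card * (k + 1) := by
        rw [Finset.offDiag_card]
        exact (Nat.sub_le _ _).trans (Nat.mul_le_mul_left _ hSr)
      exact_mod_cast this
    -- The codegree term does not shrink with `s`, but `rη ≤ κ/100` and `κ ≤ ε s^(r-1)` still make
    -- it a fraction `ε/100` of the main term.
    have h6 : (S.offDiag.card : ℝ) * (η * D) ≤ S.card * (ε / 100 * (s ^ k * D)) :=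
      calc (S.offDiag.card : ℝ) * (η * D) ≤ S.card * (k + 1 : ℕ) * (η * D) := by gcongr
        _ = S.card * (((k + 1 : ℕ) * η) * D) := by ring
        _ ≤ S.card * ((ε * s ^ k / 100) * D) := by
            have := R.r_mul_η_le
            gcongr
            linarith
        _ = _ := by ring
    nlinarith
  have hden : 0 < (edges H).card * ((1 + ε) * (s ^ (k + 1) * q)) := by positivity
  have h3 : ∀ e ∈ hitEdges H h S c, 1 / ((edges H).card * ((1 + ε) * (s ^ (k + 1) * q))) ≤
      1 / ((edges H).card * (availableColours h e).card : ℝ) := by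
    intro e he
    have hB := hC.1 e (mem_edgeSet_of_mem_hitEdges he)
    refine one_div_le_one_div_of_le ?_ ?_
    · refine mul_pos hE (lt_of_lt_of_le ?_ hB.1)
      exact mul_pos (by linarith) (by positivity)
    · exact mul_le_mul_of_nonneg_left hB.2 hE.le
  refine le_trans ?_ (Finset.card_nsmul_le_sum _ _ _ h3)
  rw [nsmul_eq_mul, mul_one_div ((hitEdges H h S c).card : ℝ), le_div_iff₀ hden]
  refine le_trans ?_ h1
  have h4 : (1 - 3 * ε) * (1 + ε) * (1 + η) ≤ 1 - ε - ε / 100 := by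
    have hb : (1 - 3 * ε) * (1 + ε) * (1 + ε / 100) ≤ 1 - ε - ε / 100 := by
      nlinarith [pow_pos hε0 2, pow_pos hε0 3]
    exact (mul_le_mul_of_nonneg_left (by linarith)
      (mul_nonneg (by linarith) (by linarith))).trans hb
  have h5 : (1 - 3 * ε) * (1 + ε) * ((edges H).card * q) ≤ (1 - ε - ε / 100) * (D * m) :=
    calc (1 - 3 * ε) * (1 + ε) * ((edges H).card * q)
        ≤ (1 - 3 * ε) * (1 + ε) * ((1 + η) * (D * m)) :=
          mul_le_mul_of_nonneg_left hEq (mul_nonneg (by linarith) (by linarith))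
      _ = (1 - 3 * ε) * (1 + ε) * (1 + η) * (D * m) := by ring
      _ ≤ _ := by gcongr
  calc S.card * (1 / (m * s)) * (1 - 3 * ε) * ((edges H).card * ((1 + ε) * (s ^ (k + 1) * q)))
      = S.card * s ^ k / m * ((1 - 3 * ε) * (1 + ε) * ((edges H).card * q)) := by
        rw [pow_succ]
        field_simp
    _ ≤ S.card * s ^ k / m * ((1 - ε - ε / 100) * (D * m)) := by gcongr
    _ = _ := by
        field_simp

end Regular

end

section

/-! ### One step of the process for a single variable -/

section Alive

variable {α : Type u} {ι : Type v} {q : ℕ}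

open Classical in
/-- The indices `x ∈ I` whose colour `col x` is still available at `S x`. -/
def alive (h : History α q) (I : Finset ι) (S : ι → Finset α) (col : ι → Fin q) : Finset ι :=
  I.filter fun x => col x ∈ availableColours h (S x : Set α)

open Classical in
/-- The indices lost when an edge `e` receives the colour `c`. -/
def lost (h : History α q) (I : Finset ι) (S : ι → Finset α) (col : ι → Fin q) (e : Set α)
    (c : Fin q) : Finset ι :=
  (alive h I S col).filter fun x => col x = c ∧ (e ∩ (S x : Set α)).Nonempty

theorem card_alive_append (h : History α q) (I : Finset ι) (S : ι → Finset α) (col : ι → Fin q)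
    (e : Set α) (c : Fin q) :
    ((alive (h ++ [(e, c)]) I S col).card : ℝ) =
      (alive h I S col).card - (lost h I S col e c).card := by
  classical
  have h1 : alive (h ++ [(e, c)]) I S col =
      (alive h I S col).filter fun x => ¬(col x = c ∧ (e ∩ (S x : Set α)).Nonempty) := by
    ext x
    simp only [alive, Finset.mem_filter, mem_availableColours_append]
    rw [and_assoc]
    refine and_congr_right fun _ => and_congr_right fun _ => ?_
    rw [not_and', ne_comm]
  have h2 := Finset.card_filter_add_card_filter_not (s := alive h I S col)
    fun x => col x = c ∧ (e ∩ (S x : Set α)).Nonempty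
  rw [h1, lost, ← h2]
  push_cast
  ring

end Alive

variable {α : Type u} [Finite α]

/-- The conditional expectation of `F` after one more step. -/
def stepMean (H : Hypergraph α) {q : ℕ} (h : History α q) (F : History α q → ℝ) : ℝ :=
  ∑ e ∈ edges H, ∑ c ∈ availableColours h e,
    1 / ((edges H).card * (availableColours h e).card : ℝ) * F (h ++ [(e, c)])

theorem stepMean_add (H : Hypergraph α) {q : ℕ} (h : History α q) (F G : History α q → ℝ) :
    stepMean H h (fun h' => F h' + G h') = stepMean H h F + stepMean H h G := by
  simp only [stepMean, mul_add, Finset.sum_add_distrib]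

theorem stepMean_sum (H : Hypergraph α) {q : ℕ} (h : History α q) {ι : Type*} (s : Finset ι)
    (F : ι → History α q → ℝ) :
    stepMean H h (fun h' => ∑ x ∈ s, F x h') = ∑ x ∈ s, stepMean H h (F x) := by
  classical
  induction s using Finset.induction_on with
  | empty => simp [stepMean]
  | insert a s ha ih => simp only [Finset.sum_insert ha, stepMean_add, ih]

section Variable

variable {ι : Type v} {H : Hypergraph α} {q : ℕ}

/-- Linearity of expectation: the mean loss is the sum, over living indices, of the probability that
an edge meeting `S x` receives the colour `col x`. -/
theorem stepMean_lost (h : History α q) (I : Finset ι) (S : ι → Finset α) (col : ι → Fin q) :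
    ∑ b ∈ (edges H).sigma fun e => availableColours h e,
      1 / ((edges H).card * (availableColours h b.1).card : ℝ) * (lost h I S col b.1 b.2).card =
    ∑ x ∈ alive h I S col, ∑ e ∈ hitEdges H h (S x) (col x),
      1 / ((edges H).card * (availableColours h e).card : ℝ) := by
  classical
  simp only [lost, Finset.card_filter, Nat.cast_sum, Finset.mul_sum, Nat.cast_ite, Nat.cast_one,
    Nat.cast_zero, mul_ite, mul_one, mul_zero]
  rw [Finset.sum_comm]
  refine Finset.sum_congr rfl fun x _ => ?_
  rw [Finset.sum_sigma, hitEdges, Finset.sum_filter]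
  refine Finset.sum_congr rfl fun e _ => ?_
  by_cases hne : (e ∩ (S x : Set α)).Nonempty
  · simp only [hne, and_true, true_and, Finset.sum_ite_eq]
  · simp [hne]

namespace Regular

variable {n r p : ℕ} {κ η γ m D s A M l : ℝ} {h : History α q} {I : Finset ι} {S : ι → Finset α}
  {col : ι → Fin q}

/-- The exponential potential of a single variable is a supermartingale as long as all variables
are close to their trajectories. -/
theorem stepMean_exp_le (R : Regular H n r q κ η γ m D) (hs : γ ≤ s - 1 / m) (hs1 : s ≤ 1)
    (hC : Close H r κ D s h) (hp : p ≤ r) (hSp : ∀ x ∈ I, (S x).card = p)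
    (hSV : ∀ x ∈ I, (S x : Set α) ⊆ H.vertexSet) (hA : 0 ≤ A)
    (hM : ∀ e ∈ H.edgeSet, ∀ c, ((lost h I S col e c).card : ℝ) ≤ M) (hl : 0 ≤ l)
    (hlM : l * M ≤ κ)
    (hX : IsApprox ((alive h I S col).card : ℝ) (κ / s ^ (9 * r)) (s ^ p * A)) :
    stepMean H h (fun h' => Real.exp (l * ((alive h' I S col).card -
        (1 + κ / (s - 1 / m) ^ (9 * r)) * ((s - 1 / m) ^ p * A)))) ≤
      Real.exp (l * ((alive h I S col).card - (1 + κ / s ^ (9 * r)) * (s ^ p * A))) ∧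
    stepMean H h (fun h' => Real.exp (l *
        ((1 - κ / (s - 1 / m) ^ (9 * r)) * ((s - 1 / m) ^ p * A) - (alive h' I S col).card))) ≤
      Real.exp (l * ((1 - κ / s ^ (9 * r)) * (s ^ p * A) - (alive h I S col).card)) := by
  classical
  have hm := R.m_pos
  have hγ := R.γ_pos
  have hm' : 0 < 1 / m := by positivity
  have hsγ : γ ≤ s := by linarith
  have hs0 : 0 < s := by linarith
  set x := 1 / (m * s) with hx
  have hsx : s - 1 / m = s * (1 - x) := by
    rw [hx]
    field_simp
  have hx0 : 0 ≤ x := by positivity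
  have hx1 : x < 1 := by
    by_contra hcon
    have : s * (1 - x) ≤ 0 := mul_nonpos_of_nonneg_of_nonpos hs0.le (by linarith)
    linarith
  set ε := κ / s ^ (9 * r) with hε
  have hε0 := R.error_pos hsγ
  have hε1 := R.error_le' hsγ
  have hκε := R.κ_le_error hsγ hs1
  rw [← hε] at hε0 hε1 hκε
  have hε' : κ / (s - 1 / m) ^ (9 * r) = ε / (1 - x) ^ (9 * r) := by
    rw [hsx, mul_pow, hε, div_div]
  have hB' : (s - 1 / m) ^ p * A = (1 - x) ^ p * (s ^ p * A) := by
    rw [hsx, mul_pow]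
    ring
  have hu0 : 0 ≤ p * x := by positivity
  -- This bounds the discretisation error: `1/m ≤ η`, `rη ≤ κ/100` and `κ ≤ ε s`.
  have huε : p * x ≤ ε := by
    have h1 := R.κ_le_error_mul hsγ hs1 (k := 1) (by have := R.one_lt_r; omega)
    rw [pow_one, ← hε] at h1
    have h2 : (p : ℝ) ≤ r := by exact_mod_cast hp
    have h3 : (r : ℝ) * (1 / m) ≤ ε * s := by
      have := mul_le_mul_of_nonneg_left R.inv_m_le R.r_pos.le
      have := R.r_mul_η_le
      have := R.κ_pos
      linarith
    have h4 : (p : ℝ) * x = p * (1 / m) / s := by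
      rw [hx]
      field_simp
    rw [h4, div_le_iff₀ hs0]
    exact (mul_le_mul_of_nonneg_right h2 hm'.le).trans h3
  have hB : 0 ≤ s ^ p * A := by positivity
  let T : Finset ((_ : Set α) × Fin q) := (edges H).sigma fun e => availableColours h e
  let w : ((_ : Set α) × Fin q) → ℝ := fun b =>
    1 / ((edges H).card * (availableColours h b.1).card : ℝ)
  let L : ((_ : Set α) × Fin q) → ℝ := fun b => (lost h I S col b.1 b.2).card
  have hQ : ∀ e ∈ H.edgeSet, (0 : ℝ) < (availableColours h e).card := fun e he =>
    lt_of_lt_of_le (mul_pos (by linarith) (mul_pos (by positivity) R.q_pos)) (hC.1 e he).1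
  have hw : ∀ b ∈ T, 0 ≤ w b := fun b _ => by positivity
  have hw1 : ∑ b ∈ T, w b = 1 := by
    have hE := R.card_edges_pos
    simp only [T, w, Finset.sum_sigma, Finset.sum_const, nsmul_eq_mul]
    have h1 : ∀ e ∈ edges H, ((availableColours h e).card : ℝ) *
        (1 / ((edges H).card * (availableColours h e).card)) = 1 / (edges H).card := by
      intro e he
      have := hQ e (mem_edges.1 he)
      field_simp
    rw [Finset.sum_congr rfl h1, Finset.sum_const, nsmul_eq_mul]
    field_simp
  have hL : ∀ b ∈ T, 0 ≤ L b ∧ L b ≤ M := fun b hb =>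
    ⟨by positivity, hM b.1 (mem_edges.1 (Finset.mem_sigma.1 hb).1) b.2⟩
  have hmean : ∑ b ∈ T, w b * L b = ∑ y ∈ alive h I S col, ∑ e ∈ hitEdges H h (S y) (col y),
      1 / ((edges H).card * (availableColours h e).card : ℝ) := stepMean_lost h I S col
  have hsum : ∀ F : ℝ → ℝ, stepMean H h (fun h' => F (alive h' I S col).card) =
      ∑ b ∈ T, w b * F ((alive h I S col).card - L b) := by
    intro F
    simp only [T, w, L, stepMean, Finset.sum_sigma, card_alive_append]
  rw [hsum fun y => Real.exp (l * (y -
      (1 + κ / (s - 1 / m) ^ (9 * r)) * ((s - 1 / m) ^ p * A))),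
    hsum fun y => Real.exp (l *
      ((1 - κ / (s - 1 / m) ^ (9 * r)) * ((s - 1 / m) ^ p * A) - y)), hε', hB']
  have hal : ∀ y ∈ alive h I S col, y ∈ I ∧ col y ∈ availableColours h (S y : Set α) :=
    fun y hy => Finset.mem_filter.1 hy
  constructor
  · refine sum_exp_upper_le hw hw1 hL hl hlM hκε hε0.le hε1 hB hX.1 hu0 ?_ ?_
    · rw [hmean, ← nsmul_eq_mul]
      refine Finset.card_nsmul_le_sum _ _ _ fun y hy => ?_
      have := R.le_rate hsγ hs1 hC (hSV y (hal y hy).1) ((hSp y (hal y hy).1).trans_le hp)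
        (hal y hy).2
      rwa [hSp y (hal y hy).1] at this
    · have := mul_le_mul_of_nonneg_left (upper_decrement_le hp hx0 hx1 hε0.le) hB
      linarith
  · refine sum_exp_lower_le hw hw1 hL hl hlM hκε hε0.le hε1 hB hX.2 hu0 huε ?_ ?_
    · rw [hmean, ← nsmul_eq_mul]
      refine Finset.sum_le_card_nsmul _ _ _ fun y hy => ?_
      have := R.rate_le hsγ hs1 hC (hSV y (hal y hy).1) (hal y hy).2
      rwa [hSp y (hal y hy).1] at this
    · have := mul_le_mul_of_nonneg_left (le_lower_decrement hp hx0 hx1 hε0.le) hB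
      linarith

end Regular

end Variable

end

section

/-! ### The potential of the whole process -/

variable {α : Type u} [Finite α]

/-- The exponential penalty for `X` leaving the interval `[(1 - ε) B, (1 + ε) B]`. -/
def penalty (l ε B X : ℝ) : ℝ :=
  Real.exp (l * (X - (1 + ε) * B)) + Real.exp (l * ((1 - ε) * B - X))

theorem penalty_nonneg (l ε B X : ℝ) : 0 ≤ penalty l ε B X := by
  unfold penalty
  positivity

theorem one_le_penalty {l ε B X : ℝ} (hl : 0 ≤ l) (h : ¬IsApprox X ε B) :
    1 ≤ penalty l ε B X := by
  have h1 := Real.exp_pos (l * (X - (1 + ε) * B))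
  have h2 := Real.exp_pos (l * ((1 - ε) * B - X))
  unfold penalty
  rw [IsApprox, not_and_or, not_le, not_le] at h
  rcases h with h | h
  · have : 1 ≤ Real.exp (l * ((1 - ε) * B - X)) :=
      Real.one_le_exp (mul_nonneg hl (by linarith))
    linarith
  · have : 1 ≤ Real.exp (l * (X - (1 + ε) * B)) :=
      Real.one_le_exp (mul_nonneg hl (by linarith))
    linarith

/-- The sum of the penalties of all variables. -/
def potential (H : Hypergraph α) (r : ℕ) (κ η D s : ℝ) {q : ℕ} (h : History α q) : ℝ :=
  ∑ e ∈ edges H, penalty κ (κ / s ^ (9 * r)) (s ^ r * q) (availableColours h e).card +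
  ∑ v ∈ H.vertexSet.toFinite.toFinset, ∑ c : Fin q,
    penalty (κ / (r * η * D)) (κ / s ^ (9 * r)) (s ^ (r - 1) * D)
      (availableEdgesFinset H h v c).card

theorem potential_nonneg (H : Hypergraph α) (r : ℕ) (κ η D s : ℝ) {q : ℕ} (h : History α q) :
    0 ≤ potential H r κ η D s h :=
  add_nonneg (Finset.sum_nonneg fun _ _ => penalty_nonneg _ _ _ _)
    (Finset.sum_nonneg fun _ _ => Finset.sum_nonneg fun _ _ => penalty_nonneg _ _ _ _)

/-- The history has `i` steps and was close to the trajectories at all times. -/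
def CloseUpTo (H : Hypergraph α) (r : ℕ) (κ D m : ℝ) {q : ℕ} (i : ℕ)
    (h : History α q) : Prop :=
  h.length = i ∧ ∀ j ≤ i, Close H r κ D (1 - j / m) (h.take j)

open Classical in
/-- The potential, stopped at the first time the process is not close to its trajectory. -/
def stoppedPotential (H : Hypergraph α) (r : ℕ) (κ η D m : ℝ) {q : ℕ}
    (i : ℕ) (h : History α q) : ENNReal :=
  if CloseUpTo H r κ D m i h then ENNReal.ofReal (potential H r κ η D (1 - i / m) h) else 1

namespace Regular

variable {H : Hypergraph α} {n r q : ℕ} {κ η γ m D s : ℝ} {h : History α q}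

theorem one_le_potential (R : Regular H n r q κ η γ m D) (hC : ¬Close H r κ D s h) :
    1 ≤ potential H r κ η D s h := by
  have hη := R.η_pos
  have hD := R.D_pos
  have hκ := R.κ_pos
  have h1 : ∀ e ∈ edges H,
      0 ≤ penalty κ (κ / s ^ (9 * r)) (s ^ r * q) (availableColours h e).card :=
    fun _ _ => penalty_nonneg _ _ _ _
  have h2 : ∀ v, ∀ c ∈ (Finset.univ : Finset (Fin q)), 0 ≤ penalty (κ / (r * η * D))
      (κ / s ^ (9 * r)) (s ^ (r - 1) * D) (availableEdgesFinset H h v c).card :=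
    fun _ _ _ => penalty_nonneg _ _ _ _
  have h3 : ∀ v ∈ H.vertexSet.toFinite.toFinset, 0 ≤ ∑ c : Fin q, penalty (κ / (r * η * D))
      (κ / s ^ (9 * r)) (s ^ (r - 1) * D) (availableEdgesFinset H h v c).card :=
    fun v _ => Finset.sum_nonneg (h2 v)
  unfold potential
  rw [Close, not_and_or] at hC
  push Not at hC
  rcases hC with ⟨e, he, hX⟩ | ⟨v, hv, c, hX⟩
  · have h4 := Finset.single_le_sum h1 (mem_edges.2 he)
    have h5 := one_le_penalty hκ.le hX
    have h6 := Finset.sum_nonneg h3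
    linarith
  · have h4 := Finset.single_le_sum h3 (H.vertexSet.toFinite.mem_toFinset.2 hv)
    have h5 := Finset.single_le_sum (h2 v) (Finset.mem_univ c)
    have h6 := one_le_penalty (l := κ / (r * η * D)) (by positivity) hX
    have h7 := Finset.sum_nonneg h1
    linarith

theorem stepMean_penalty_colours (R : Regular H n r q κ η γ m D) (hs : γ ≤ s - 1 / m)
    (hs1 : s ≤ 1) (hC : Close H r κ D s h) {e : Set α} (he : e ∈ H.edgeSet) :
    stepMean H h (fun h' => penalty κ (κ / (s - 1 / m) ^ (9 * r)) ((s - 1 / m) ^ r * q)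
      (availableColours h' e).card) ≤
    penalty κ (κ / s ^ (9 * r)) (s ^ r * q) (availableColours h e).card := by
  classical
  let S : Fin q → Finset α := fun _ => e.toFinite.toFinset
  have hal : ∀ h' : History α q, alive h' Finset.univ S id = availableColours h' e := by
    intro h'
    ext c
    simp [alive, S]
  -- The indices are the colours, all tested at `e`. A step assigns one colour, so at most one index
  -- is lost.
  have key := R.stepMean_exp_le (I := Finset.univ) (S := S) (col := id) (p := r) (A := q)
    (M := 1) (l := κ) hs hs1 hC le_rfl
    (fun x _ => by
      rw [← (R.uniform e he).2, Set.ncard_eq_toFinset_card])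
    (fun x _ => by
      simpa [S] using H.subset_vertexSet_of_mem_edgeSet he)
    (Nat.cast_nonneg _)
    (fun e' _ c => by
      have : (lost h Finset.univ S id e' c).card ≤ 1 := by
        refine Finset.card_le_one.2 fun x hx y hy => ?_
        have h1 : x = c := (Finset.mem_filter.1 hx).2.1
        have h2 : y = c := (Finset.mem_filter.1 hy).2.1
        rw [h1, h2]
      exact_mod_cast this)
    R.κ_pos.le (by simp) (by rw [hal]; exact hC.1 e he)
  simp only [hal] at key
  unfold penalty
  rw [stepMean_add]
  exact add_le_add key.1 key.2

theorem stepMean_penalty_edges (R : Regular H n r q κ η γ m D) (hs : γ ≤ s - 1 / m)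
    (hs1 : s ≤ 1) (hC : Close H r κ D s h) {v : α} (hv : v ∈ H.vertexSet) (c : Fin q) :
    stepMean H h (fun h' => penalty (κ / (r * η * D)) (κ / (s - 1 / m) ^ (9 * r))
      ((s - 1 / m) ^ (r - 1) * D) (availableEdgesFinset H h' v c).card) ≤
    penalty (κ / (r * η * D)) (κ / s ^ (9 * r)) (s ^ (r - 1) * D)
      (availableEdgesFinset H h v c).card := by
  classical
  have hη := R.η_pos
  have hD := R.D_pos
  have hκ := R.κ_pos
  have hr := R.r_pos
  let S : Set α → Finset α := fun f => (f \ {v}).toFinite.toFinset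
  let I : Finset (Set α) := (edges H).filter (v ∈ ·)
  have hI : ∀ f ∈ I, f ∈ H.edgeSet ∧ v ∈ f := fun f hf => by simpa [I] using hf
  have hal : ∀ h' : History α q, alive h' I S (fun _ => c) = availableEdgesFinset H h' v c := by
    intro h'
    ext f
    simp [alive, S, I, availableEdgesFinset]
  have hlost : ∀ e' ∈ H.edgeSet, ∀ c' : Fin q,
      ((lost h I S (fun _ => c) e' c').card : ℝ) ≤ r * η * D := by
    intro e' he' c'
    -- A lost edge contains `v` and some vertex `y ≠ v` of the newly coloured edge, so the loss is
    -- at most `r` codegrees.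
    have h1 : lost h I S (fun _ => c) e' c' ⊆
        (e' \ {v}).toFinite.toFinset.biUnion fun y => (edges H).filter fun f => v ∈ f ∧ y ∈ f := by
      intro f hf
      obtain ⟨hf1, -, y, hye, hyS⟩ := Finset.mem_filter.1 hf
      have hf2 := hI f (Finset.mem_filter.1 hf1).1
      have hy : y ∈ f ∧ y ≠ v := by simpa [S] using hyS
      refine Finset.mem_biUnion.2 ⟨y, ?_, ?_⟩
      · simpa using ⟨hye, hy.2⟩
      · simpa using ⟨hf2.1, hf2.2, hy.1⟩
    have h2 := (Finset.card_le_card h1).trans Finset.card_biUnion_le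
    simp only [← codegree_eq_card] at h2
    have h3 : ((lost h I S (fun _ => c) e' c').card : ℝ) ≤
        ∑ y ∈ (e' \ {v}).toFinite.toFinset, (codegree H v y : ℝ) := by exact_mod_cast h2
    have h4 : ∑ y ∈ (e' \ {v}).toFinite.toFinset, (codegree H v y : ℝ) ≤
        (e' \ {v}).toFinite.toFinset.card • (η * D) := by
      refine Finset.sum_le_card_nsmul _ _ _ fun y hy => ?_
      have hy' : y ∈ e' ∧ y ≠ v := by simpa using hy
      exact R.codegree_le v hv y (H.subset_vertexSet_of_mem_edgeSet he' hy'.1) hy'.2.symm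
    have h5 : (e' \ {v}).toFinite.toFinset.card ≤ r := by
      rw [← Set.ncard_eq_toFinset_card, ← (R.uniform e' he').2]
      exact Set.ncard_le_ncard Set.sdiff_subset e'.toFinite
    have h6 : ((e' \ {v}).toFinite.toFinset.card : ℝ) ≤ r := by exact_mod_cast h5
    rw [nsmul_eq_mul] at h4
    rw [mul_assoc]
    exact (h3.trans h4).trans (by gcongr)
  have key := R.stepMean_exp_le (I := I) (S := S) (col := fun _ => c) (p := r - 1) (A := D)
    (M := r * η * D) (l := κ / (r * η * D)) hs hs1 hC (Nat.sub_le _ _)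
    (fun f hf => by
      rw [← (R.uniform f (hI f hf).1).2, ← Set.ncard_eq_toFinset_card,
        Set.ncard_sdiff_singleton_of_mem (hI f hf).2])
    (fun f hf => by
      rw [Set.Finite.coe_toFinset]
      exact Set.sdiff_subset.trans (H.subset_vertexSet_of_mem_edgeSet (hI f hf).1))
    hD.le hlost (by positivity) (by field_simp; rfl) (by rw [hal]; exact hC.2 v hv c)
  simp only [hal] at key
  unfold penalty
  rw [stepMean_add]
  exact add_le_add key.1 key.2

theorem stepMean_potential_le (R : Regular H n r q κ η γ m D) (hs : γ ≤ s - 1 / m)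
    (hs1 : s ≤ 1) (hC : Close H r κ D s h) :
    stepMean H h (fun h' => potential H r κ η D (s - 1 / m) h') ≤ potential H r κ η D s h := by
  unfold potential
  simp only [stepMean_add, stepMean_sum]
  refine add_le_add (Finset.sum_le_sum fun e he => ?_)
    (Finset.sum_le_sum fun v hv => Finset.sum_le_sum fun c _ => ?_)
  · exact R.stepMean_penalty_colours hs hs1 hC (mem_edges.1 he)
  · exact R.stepMean_penalty_edges hs hs1 hC (H.vertexSet.toFinite.mem_toFinset.1 hv) c

theorem not_terminated (R : Regular H n r q κ η γ m D) (hs : γ ≤ s) (hC : Close H r κ D s h) :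
    H.edgeSet.Nonempty ∧ ∀ e ∈ H.edgeSet, (availableColours h e).Nonempty := by
  constructor
  · have h1 : 0 < (edges H).card := by exact_mod_cast R.card_edges_pos
    obtain ⟨e, he⟩ := Finset.card_pos.1 h1
    exact ⟨e, mem_edges.1 he⟩
  · intro e he
    have h1 : (0 : ℝ) < (availableColours h e).card := by
      refine lt_of_lt_of_le (mul_pos ?_ (mul_pos (pow_pos (R.γ_pos.trans_le hs) _) R.q_pos))
        (hC.1 e he).1
      have := R.error_le' hs
      linarith
    exact Finset.card_pos.1 (by exact_mod_cast h1)

/-- Before failure the potential is a supermartingale, and replacing it by `1` upon failure only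
lowers it. After failure the value stays `1`. -/
theorem expect_stoppedPotential_step_le (R : Regular H n r q κ η γ m D) {i : ℕ}
    (hi : γ ≤ 1 - (i + 1 : ℕ) / m) (hlen : h.length ≤ i) :
    expect (step H h) (stoppedPotential H r κ η D m (i + 1)) ≤
      stoppedPotential H r κ η D m i h := by
  classical
  have hm := R.m_pos
  have hstep : (1 - (i + 1 : ℕ) / m : ℝ) = 1 - i / m - 1 / m := by
    push_cast
    ring
  by_cases hC : CloseUpTo H r κ D m i h
  · have hCi : Close H r κ D (1 - i / m) h := by
      have := hC.2 i le_rfl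
      rwa [← hC.1, List.take_length, hC.1] at this
    rw [hstep] at hi
    have hm' : 0 < 1 / m := by positivity
    have hs1 : 1 - (i : ℝ) / m ≤ 1 := by
      have : 0 ≤ (i : ℝ) / m := by positivity
      linarith
    have hh := R.not_terminated (by linarith) hCi
    rw [stoppedPotential, if_pos hC]
    refine le_trans ?_ (ENNReal.ofReal_le_ofReal (R.stepMean_potential_le hi hs1 hCi))
    unfold stepMean
    rw [← expect_step H h hh (potential H r κ η D (1 - i / m - 1 / m))
      fun h' => potential_nonneg _ _ _ _ _ _ _]
    refine expect_mono _ fun h' hh' => ?_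
    rw [stoppedPotential, hstep]
    split_ifs with hC'
    · exact le_rfl
    · rw [ENNReal.one_le_ofReal]
      refine R.one_le_potential fun hclose => hC' ?_
      obtain ⟨e, c, rfl⟩ := exists_of_mem_support_step hh hh'
      have hl' : (h ++ [(e, c)]).length = i + 1 := by simp [hC.1]
      refine ⟨hl', fun j hj => ?_⟩
      rcases Nat.lt_or_ge i j with hij | hij
      · obtain rfl : j = i + 1 := by omega
        rw [hstep, ← hl', List.take_length]
        exact hclose
      · rw [List.take_append_of_le_length (by rw [hC.1]; exact hij)]
        exact hC.2 j hij
  -- Failure is permanent: a close history of `i + 1` steps has a close prefix of `i` steps. The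
  -- bound on the length excludes a history that merely stood still.
  · rw [stoppedPotential, if_neg hC, ← expect_one (step H h)]
    refine expect_mono _ fun h' hh' => ?_
    rw [stoppedPotential, if_neg]
    rintro ⟨hl', hall⟩
    rcases eq_of_mem_support_step hh' with rfl | ⟨e, c, rfl⟩
    · omega
    · have hl : h.length = i := by simpa using hl'
      refine hC ⟨hl, fun j hj => ?_⟩
      have := hall j (by omega)
      rwa [List.take_append_of_le_length (by rw [hl]; exact hj)] at this

theorem expect_stoppedPotential_le (R : Regular H n r q κ η γ m D) (i : ℕ)
    (hi : γ ≤ 1 - i / m) :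
    expect (law H q i) (stoppedPotential H r κ η D m i) ≤
      ENNReal.ofReal (potential H r κ η D 1 ([] : History α q)) := by
  classical
  induction i with
  | zero =>
    rw [law, expect_pure, stoppedPotential]
    split_ifs with hC
    · simp
    · rw [ENNReal.one_le_ofReal]
      refine R.one_le_potential fun hclose => hC ⟨rfl, fun j hj => ?_⟩
      obtain rfl : j = 0 := by omega
      simpa using hclose
  | succ i ih =>
    rw [law, expect_bind]
    have hm := R.m_pos
    refine le_trans (expect_mono _ fun h hh => ?_) (ih (hi.trans ?_))
    · exact R.expect_stoppedPotential_step_le hi (length_le_of_mem_support_law i hh)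
    · push_cast
      gcongr
      linarith

theorem one_sub_potential_le (R : Regular H n r q κ η γ m D) (N : ℕ) (hN : γ ≤ 1 - N / m) :
    1 - potential H r κ η D 1 ([] : History α q) ≤
      ((law H q N).toOuterMeasure {h | CloseUpTo H r κ D m N h}).toReal := by
  refine one_sub_le_toOuterMeasure _ _ (stoppedPotential H r κ η D m N) (fun h hh => ?_)
    (potential_nonneg _ _ _ _ _ _ _) (R.expect_stoppedPotential_le N hN)
  have hh' : ¬CloseUpTo H r κ D m N h := hh
  rw [stoppedPotential, if_neg hh']

/-- Initially `|Q_e| = q`, giving exponents `-κ² q` with `q ≥ 1/(2rη)`; and `|Y_{v,c}|` is the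
degree of `v`, within `ηD` of `D`, giving exponents at most `-κ(κ-η)/(rη)`. -/
theorem potential_nil_le (R : Regular H n r q κ η γ m D) :
    potential H r κ η D 1 ([] : History α q) ≤
      2 * ((edges H).card + n * q) * Real.exp (-(κ ^ 2 / (2 * r * η))) := by
  classical
  have hη := R.η_pos
  have hD := R.D_pos
  have hκ := R.κ_pos
  have hr := R.r_pos
  have hn := R.n_pos'
  have hηκ := R.η_le
  have hκ1 := R.κ_le
  have hm := R.m_pos
  have hr2 : (2 : ℝ) ≤ r := by exact_mod_cast R.one_lt_r
  set E := Real.exp (-(κ ^ 2 / (2 * r * η))) with hE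
  have h1 : ∀ e ∈ edges H, penalty κ (κ / 1 ^ (9 * r)) (1 ^ r * q)
      (availableColours ([] : History α q) e).card ≤ 2 * E := by
    intro e _
    rw [availableColours_nil, Finset.card_univ, Fintype.card_fin]
    have hq : 1 / (2 * r * η) ≤ q := by
      refine le_trans ?_ R.le_q
      have h0 : 1 / η ≤ m / n := by
        rw [div_le_div_iff₀ hη hn]
        have := (div_le_iff₀ hm).1 R.n_div_m_le
        linarith
      have h3 : 1 / (2 * r * η) ≤ 1 / η := by
        refine one_div_le_one_div_of_le hη ?_
        nlinarith
      have h4 : m / n ≤ (1 - η) * (r * m / n) := by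
        have h5 : (1 : ℝ) ≤ (1 - η) * r := by nlinarith
        calc m / n = 1 * (m / n) := (one_mul _).symm
          _ ≤ (1 - η) * r * (m / n) := by gcongr
          _ = _ := by ring
      linarith
    have hexp : Real.exp (-(κ * (κ * q))) ≤ E := by
      rw [hE, Real.exp_le_exp]
      have := mul_le_mul_of_nonneg_left hq (by positivity : 0 ≤ κ * κ)
      have h3 : κ ^ 2 / (2 * r * η) = κ * κ * (1 / (2 * r * η)) := by ring
      rw [h3]
      linarith
    have e1 : κ * ((q : ℝ) - (1 + κ) * q) = -(κ * (κ * q)) := by ring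
    have e2 : κ * ((1 - κ) * q - (q : ℝ)) = -(κ * (κ * q)) := by ring
    simp only [penalty, one_pow, div_one, one_mul, e1, e2]
    linarith
  have h2 : ∀ v ∈ H.vertexSet.toFinite.toFinset, ∀ c : Fin q,
      penalty (κ / (r * η * D)) (κ / 1 ^ (9 * r)) (1 ^ (r - 1) * D)
        (availableEdgesFinset H ([] : History α q) v c).card ≤ 2 * E := by
    intro v hv c
    have hv' : v ∈ H.vertexSet := by simpa using hv
    have hY : availableEdgesFinset H ([] : History α q) v c = (edges H).filter (v ∈ ·) := by
      ext f
      simp [availableEdgesFinset, availableColours_nil]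
    rw [hY, ← degree_eq_card]
    have hd1 := R.le_degree v hv'
    have hd2 := R.degree_le v hv'
    have hl : 0 < κ / (r * η * D) := by positivity
    have hb : κ ^ 2 / (2 * r * η) ≤ κ / (r * η * D) * ((κ - η) * D) := by
      have : κ / (r * η * D) * ((κ - η) * D) = κ * (2 * (κ - η)) / (2 * r * η) := by
        field_simp
      rw [this]
      gcongr
      nlinarith
    have e1 : κ / (r * η * D) * (degree H v - (1 + κ) * D) ≤ -(κ ^ 2 / (2 * r * η)) := by
      have : κ / (r * η * D) * (degree H v - (1 + κ) * D) ≤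
          κ / (r * η * D) * (-((κ - η) * D)) :=
        mul_le_mul_of_nonneg_left (by linarith) hl.le
      linarith
    have e2 : κ / (r * η * D) * ((1 - κ) * D - degree H v) ≤ -(κ ^ 2 / (2 * r * η)) := by
      have : κ / (r * η * D) * ((1 - κ) * D - degree H v) ≤
          κ / (r * η * D) * (-((κ - η) * D)) :=
        mul_le_mul_of_nonneg_left (by linarith) hl.le
      linarith
    simp only [penalty, one_pow, div_one, one_mul]
    have := Real.exp_le_exp.2 e1
    have := Real.exp_le_exp.2 e2
    linarith
  have h3 : ∑ e ∈ edges H, penalty κ (κ / 1 ^ (9 * r)) (1 ^ r * q)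
      (availableColours ([] : History α q) e).card ≤ (edges H).card * (2 * E) := by
    rw [← nsmul_eq_mul]
    exact Finset.sum_le_card_nsmul _ _ _ h1
  have h4 : ∑ v ∈ H.vertexSet.toFinite.toFinset, ∑ c : Fin q,
      penalty (κ / (r * η * D)) (κ / 1 ^ (9 * r)) (1 ^ (r - 1) * D)
        (availableEdgesFinset H ([] : History α q) v c).card ≤ n * (q * (2 * E)) := by
    refine (Finset.sum_le_card_nsmul _ _ (q * (2 * E)) fun v hv => ?_).trans_eq ?_
    · have := Finset.sum_le_card_nsmul Finset.univ _ (2 * E) fun c _ => h2 v hv c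
      rwa [Finset.card_univ, Fintype.card_fin, nsmul_eq_mul] at this
    · rw [R.card_vertices', nsmul_eq_mul]
  unfold potential
  linarith

end Regular

end

section

/-! ### The choice of parameters -/

variable {α : Type u}

theorem eHat_eq {n r : ℕ} {σ s : ℝ} (hs : 0 < 1 - s) :
    eHat n r σ s = (n : ℝ) ^ (-(σ / 3)) / (1 - s) ^ (9 * r) := by
  have h1 : (9 * (r : ℝ)) = ((9 * r : ℕ) : ℝ) := by push_cast; ring
  rw [eHat, Real.rpow_neg hs.le, h1, Real.rpow_natCast, mul_comm,
    ← div_eq_mul_inv]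

theorem rpow_natCast_eq_exp {n : ℕ} (hn : 0 < n) (x : ℝ) :
    (n : ℝ) ^ x = Real.exp (x * Real.log n) := by
  rw [Real.rpow_def_of_pos (by exact_mod_cast hn), mul_comm]

theorem regular_of_parameters {H : Hypergraph α} {σ b γ m D : ℝ} {n r : ℕ}
    (hn2 : 2 ≤ n)
    (hlog : 100 * b ≤ Real.exp (2 * σ / 3 * Real.log n) / Real.log n)
    (hsmall : 100 ≤ Real.exp (σ / 30 * Real.log n))
    (hγ0 : 0 < γ) (hγ1 : γ < 1) (hγ : b * Real.log (1 / γ) ≤ σ / 30)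
    (hr2 : 2 ≤ r) (hr : (r : ℝ) ≤ b * Real.log n) (hm : (n : ℝ) ^ (1 + σ) ≤ m) (hD : 0 < D)
    (hV : H.vertexSet.ncard = n) (hU : IsUniform H r)
    (hdeg : ∀ v ∈ H.vertexSet, |(degree H v : ℝ) - D| ≤ (n : ℝ) ^ (-σ) * D)
    (hcodeg : ∀ x ∈ H.vertexSet, ∀ y ∈ H.vertexSet, x ≠ y →
      (codegree H x y : ℝ) ≤ (n : ℝ) ^ (-σ) * D) :
    Regular H n r ⌊(r : ℝ) * m / n⌋₊ ((n : ℝ) ^ (-(σ / 3))) ((n : ℝ) ^ (-σ)) γ m D := by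
  have hn0 : (0 : ℝ) < n := by exact_mod_cast (by omega : 0 < n)
  have hn : 0 < n := by omega
  have hy : 0 < Real.log n := Real.log_pos (by exact_mod_cast (by omega : 1 < n))
  have hm0 : 0 < m := lt_of_lt_of_le (Real.rpow_pos_of_pos hn0 _) hm
  have hη0 : 0 < (n : ℝ) ^ (-σ) := Real.rpow_pos_of_pos hn0 _
  have hr0 : (1 : ℝ) ≤ r := by exact_mod_cast (by omega : 1 ≤ r)
  have hnm : n / m ≤ (n : ℝ) ^ (-σ) := by
    rw [div_le_iff₀ hm0]
    calc (n : ℝ) = (n : ℝ) ^ (-σ) * (n : ℝ) ^ (1 + σ) := by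
          rw [← Real.rpow_add hn0]
          simp
      _ ≤ _ := by gcongr
  refine ⟨hU, hV, fun v hv => ?_, fun v hv => ?_, hcodeg, hn, by omega, hD, hm0,
    Real.rpow_pos_of_pos hn0 _, hη0, hγ0, hγ1, ?_, ?_, hnm, ?_, Nat.floor_le (by positivity)⟩
  · have := (abs_le.1 (hdeg v hv)).1
    linarith
  · have := (abs_le.1 (hdeg v hv)).2
    linarith
  · have h1 : 100 * r ≤ Real.exp (2 * σ / 3 * Real.log n) := by
      rw [le_div_iff₀ hy] at hlog
      linarith
    have h2 : (n : ℝ) ^ (-(σ / 3)) = Real.exp (2 * σ / 3 * Real.log n) * (n : ℝ) ^ (-σ) := by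
      rw [rpow_natCast_eq_exp hn, rpow_natCast_eq_exp hn, ← Real.exp_add]
      ring_nf
    rw [h2, le_div_iff₀ (by norm_num)]
    nlinarith
  -- The condition on `γ` and `r ≤ b log n` give `9r log(1/γ) ≤ 9(σ/30) log n`. The final error is
  -- thus at most `n^(-σ/3 + 3σ/10) = n^(-σ/30)`.
  · have h1 : (1 / γ) ^ (9 * r) ≤ Real.exp (3 * σ / 10 * Real.log n) := by
      have hlγ : 0 ≤ Real.log (1 / γ) := Real.log_nonneg (by
        rw [le_div_iff₀ hγ0]
        linarith)
      rw [← Real.exp_log (by positivity : 0 < (1 / γ) ^ (9 * r)), Real.exp_le_exp, Real.log_pow]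
      push_cast
      have := mul_le_mul_of_nonneg_right hr hlγ
      have := mul_le_mul_of_nonneg_right hγ hy.le
      linarith
    have h2 : (n : ℝ) ^ (-(σ / 3)) * Real.exp (3 * σ / 10 * Real.log n) *
        Real.exp (σ / 30 * Real.log n) = 1 := by
      rw [rpow_natCast_eq_exp hn, ← Real.exp_add, ← Real.exp_add, Real.exp_eq_one_iff]
      ring
    have h3 : (n : ℝ) ^ (-(σ / 3)) / γ ^ (9 * r) = (n : ℝ) ^ (-(σ / 3)) * (1 / γ) ^ (9 * r) := by
      rw [one_div, inv_pow, div_eq_mul_inv]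
    rw [h3]
    have hκ : 0 < (n : ℝ) ^ (-(σ / 3)) := Real.rpow_pos_of_pos hn0 _
    have h4 := mul_le_mul_of_nonneg_left h1 hκ.le
    have h5 : 0 < (n : ℝ) ^ (-(σ / 3)) * Real.exp (3 * σ / 10 * Real.log n) := by positivity
    refine h4.trans ?_
    rw [le_div_iff₀ (by norm_num)]
    nlinarith
  · have h1 := Nat.lt_floor_add_one ((r : ℝ) * m / n)
    -- Rounding `q` down loses less than `1`, hence at most a relative `η`.
    have h2 : 1 ≤ (n : ℝ) ^ (-σ) * (r * m / n) := by
      rw [div_le_iff₀ hm0] at hnm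
      rw [← mul_div_assoc, le_div_iff₀ hn0]
      have : (n : ℝ) ^ (-σ) * m ≤ (n : ℝ) ^ (-σ) * (r * m) := by
        gcongr
        nlinarith
      linarith
    linarith

variable [Finite α]

theorem card_edges_le_pow {H : Hypergraph α} {n r : ℕ} (hu : IsUniform H r)
    (hn : H.vertexSet.ncard = n) : (edges H).card ≤ n ^ r := by
  classical
  have h1 : (edges H).card ≤ ((H.vertexSet.toFinite.toFinset).powersetCard r).card := by
    refine Finset.card_le_card_of_injOn (fun e => e.toFinite.toFinset) (fun e he => ?_)
      (fun e _ f _ hef => by simpa using hef)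
    have he' : e ∈ H.edgeSet := by simpa using he
    simp only [Finset.mem_coe, Finset.mem_powersetCard]
    refine ⟨fun v hv => ?_, ?_⟩
    · simpa using H.subset_vertexSet_of_mem_edgeSet he' (by simpa using hv)
    · rw [← Set.ncard_eq_toFinset_card, (hu e he').2]
  rw [Finset.card_powersetCard, ← Set.ncard_eq_toFinset_card, hn] at h1
  exact h1.trans (Nat.choose_le_pow n r)

theorem CloseUpTo.concentrated {H : Hypergraph α} {n r q : ℕ} {σ η γ m D : ℝ} {N : ℕ}
    (R : Regular H n r q ((n : ℝ) ^ (-(σ / 3))) η γ m D) (hN : γ ≤ 1 - N / m)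
    {h : History α q} (hC : CloseUpTo H r ((n : ℝ) ^ (-(σ / 3))) D m N h) :
    Concentrated H n r q σ m D N h := by
  refine ⟨hC.1, fun i hi => ?_⟩
  have hm := R.m_pos
  have hs : γ ≤ 1 - i / m := by
    have : (i : ℝ) / m ≤ N / m := by
      have : (i : ℝ) ≤ N := by exact_mod_cast hi
      gcongr
    linarith
  have hCi := hC.2 i hi
  rw [eHat_eq (R.γ_pos.trans_le hs)]
  refine ⟨fun e he => ?_, hCi.1, fun v hv c => ?_⟩
  · exact ((R.not_terminated hs hCi).2 e he).card_pos
  · rw [ncard_availableEdges]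
    exact hCi.2 v hv c

theorem failure_bound {H : Hypergraph α} {σ b γ m D : ℝ} {n r : ℕ} (hn2 : 2 ≤ n)
    (hb : 0 < b) (hσ : 0 < σ) (hr2 : 2 ≤ r) (hr : (r : ℝ) ≤ b * Real.log n)
    (hm : (n : ℝ) ^ (1 + σ) ≤ m)
    (hm' : m ≤ (n : ℝ) ^ ((r : ℝ) * (n : ℝ) ^ (σ / 4)))
    (R : Regular H n r ⌊(r : ℝ) * m / n⌋₊ ((n : ℝ) ^ (-(σ / 3))) ((n : ℝ) ^ (-σ)) γ m D) :
    potential H r ((n : ℝ) ^ (-(σ / 3))) ((n : ℝ) ^ (-σ)) D 1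
        ([] : History α ⌊(r : ℝ) * m / n⌋₊) ≤
      m ^ (-((Real.exp (σ / 12 * Real.log n) / Real.log n ^ (4 : ℝ) / (2 * b ^ 3) - 3) * r)) := by
  have hn : 0 < n := by omega
  have hn0 : (0 : ℝ) < n := by exact_mod_cast hn
  have hn2' : (2 : ℝ) ≤ n := by exact_mod_cast hn2
  have hy : 0 < Real.log n := Real.log_pos (by linarith)
  have hr0 := R.r_pos
  have hm0 := R.m_pos
  have hnm : n ≤ m := by
    refine le_trans ?_ hm
    calc (n : ℝ) = (n : ℝ) ^ (1 : ℝ) := (Real.rpow_one _).symm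
      _ ≤ _ := Real.rpow_le_rpow_of_exponent_le (by linarith) (by linarith)
  have hm2 : 2 ≤ m := hn2'.trans hnm
  refine R.potential_nil_le.trans ?_
  -- The number of penalty terms costs `m^(3r)`, whence the `- 3` in `w`.
  have hcount : 2 * (((edges H).card : ℝ) + n * ⌊(r : ℝ) * m / n⌋₊) ≤ m ^ (3 * r) := by
    have h1 : ((edges H).card : ℝ) ≤ m ^ r := by
      have : ((edges H).card : ℝ) ≤ n ^ r := by
        exact_mod_cast card_edges_le_pow R.uniform R.card_vertices
      exact this.trans (by gcongr)
    have h2 : (n : ℝ) * ⌊(r : ℝ) * m / n⌋₊ ≤ r * m := by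
      have := mul_le_mul_of_nonneg_left R.q_le hn0.le
      rwa [mul_div_cancel₀ _ hn0.ne'] at this
    have h3 : (r : ℝ) ≤ m ^ r := by
      have : (r : ℝ) ≤ 2 ^ r := by exact_mod_cast Nat.lt_two_pow_self.le
      exact this.trans (by gcongr)
    have h4 : 0 < m ^ r := by positivity
    calc 2 * (((edges H).card : ℝ) + n * ⌊(r : ℝ) * m / n⌋₊) ≤ 2 * (m ^ r + r * m) := by
          gcongr
      _ ≤ 2 * (m ^ r + m ^ r * m) := by gcongr
      _ ≤ m ^ r * m ^ 3 := by
          have h5 : 0 ≤ m ^ 3 - 2 - 2 * m := by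
            nlinarith [mul_nonneg hm0.le (by nlinarith : 0 ≤ m ^ 2 - 4)]
          nlinarith [mul_nonneg h4.le h5]
      _ = m ^ (r + 3) := by rw [pow_add]
      _ ≤ m ^ (3 * r) := pow_le_pow_right₀ (by linarith) (by omega)
  have hexp : ((n : ℝ) ^ (-(σ / 3))) ^ 2 / (2 * r * (n : ℝ) ^ (-σ)) =
      Real.exp (σ / 3 * Real.log n) / (2 * r) := by
    rw [rpow_natCast_eq_exp hn, rpow_natCast_eq_exp hn, div_eq_div_iff (by positivity)
      (by positivity), ← Real.exp_nat_mul]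
    have : Real.exp (σ / 3 * Real.log n) * (2 * r * Real.exp (-σ * Real.log n)) =
        Real.exp (σ / 3 * Real.log n + -σ * Real.log n) * (2 * r) := by
      rw [Real.exp_add]
      ring
    rw [this]
    congr 2
    push_cast
    ring
  rw [hexp]
  refine (mul_le_mul_of_nonneg_right hcount (Real.exp_pos _).le).trans ?_
  set W := Real.exp (σ / 12 * Real.log n) / Real.log n ^ (4 : ℝ) / (2 * b ^ 3) with hW
  have hlogm : Real.log m ≤ r * Real.exp (σ / 4 * Real.log n) * Real.log n := by
    have := Real.log_le_log hm0 hm'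
    rwa [Real.log_rpow hn0, rpow_natCast_eq_exp hn] at this
  -- The upper bound on `m` gives `log m ≤ r n^(σ/4) log n`; with `r ≤ b log n`, it suffices that
  -- `2W b³ (log n)^4 ≤ n^(σ/3 - σ/4)`, and `W` is chosen to give equality.
  have hmain : W * r * Real.log m ≤ Real.exp (σ / 3 * Real.log n) / (2 * r) := by
    rw [le_div_iff₀ (by positivity)]
    have hW0 : 0 < W := by positivity
    have h3 : (r : ℝ) ^ 3 ≤ (b * Real.log n) ^ 3 := by gcongr
    calc W * r * Real.log m * (2 * r)
        ≤ W * r * (r * Real.exp (σ / 4 * Real.log n) * Real.log n) * (2 * r) := by gcongr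
      _ = 2 * W * Real.exp (σ / 4 * Real.log n) * Real.log n * (r : ℝ) ^ 3 := by ring
      _ ≤ 2 * W * Real.exp (σ / 4 * Real.log n) * Real.log n * (b * Real.log n) ^ 3 := by gcongr
      _ = Real.exp (σ / 12 * Real.log n) * Real.exp (σ / 4 * Real.log n) := by
          have : Real.log n ^ (4 : ℝ) = Real.log n ^ 4 := by norm_cast
          rw [hW, this]
          field_simp
      _ = _ := by
          rw [← Real.exp_add]
          ring_nf
  rw [Real.rpow_def_of_pos hm0, ← Real.exp_log (by positivity : 0 < m ^ (3 * r)), ← Real.exp_add,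
    Real.exp_le_exp, Real.log_pow]
  push_cast
  linarith

end

end RandomGreedyColouring

end

open RandomGreedyColouring in
theorem mainTheorem6 (σ b : ℝ) (hσ : 0 < σ) (hb : 0 < b) :
    ∃ (n₀ : ℕ) (w : ℕ → ℝ), Tendsto w atTop atTop ∧
      ∀ γ : ℝ, 0 < γ → γ < 1 → b * Real.log (1 / γ) ≤ σ / 30 →
      ∀ n : ℕ, n₀ ≤ n →
      ∀ r : ℕ, 2 ≤ r → (r : ℝ) ≤ b * Real.log n →
      ∀ m : ℝ, (n : ℝ) ^ (1 + σ) ≤ m → m ≤ (n : ℝ) ^ ((r : ℝ) * (n : ℝ) ^ (σ / 4)) →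
      ∀ D : ℝ, 0 < D →
      ∀ (α : Type*) [Finite α] (H : Hypergraph α),
        H.vertexSet.ncard = n →
        RandomGreedyColouring.IsUniform H r →
        (∀ v ∈ H.vertexSet,
          |(RandomGreedyColouring.degree H v : ℝ) - D| ≤ (n : ℝ) ^ (-σ) * D) →
        (∀ u ∈ H.vertexSet, ∀ v ∈ H.vertexSet, u ≠ v →
          (RandomGreedyColouring.codegree H u v : ℝ) ≤ (n : ℝ) ^ (-σ) * D) →
        1 - m ^ (-(w n * r)) ≤
          ((RandomGreedyColouring.law H ⌊(r : ℝ) * m / n⌋₊ ⌊(1 - γ) * m⌋₊).toOuterMeasure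
            {h | RandomGreedyColouring.Concentrated H n r ⌊(r : ℝ) * m / n⌋₊ σ m D
              ⌊(1 - γ) * m⌋₊ h}).toReal := by
  have hlogn : Tendsto (fun n : ℕ => Real.log n) atTop atTop :=
    Real.tendsto_log_atTop.comp tendsto_natCast_atTop_atTop
  have hev1 : ∀ᶠ n : ℕ in atTop, 100 * b ≤ Real.exp (2 * σ / 3 * Real.log n) / Real.log n := by
    have h1 := (tendsto_exp_mul_div_rpow_atTop 1 (2 * σ / 3) (by positivity)).comp hlogn
    filter_upwards [h1.eventually_ge_atTop (100 * b)] with n hn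
    simpa using hn
  have hev2 : ∀ᶠ n : ℕ in atTop, 100 ≤ Real.exp (σ / 30 * Real.log n) :=
    (Real.tendsto_exp_atTop.comp (hlogn.const_mul_atTop (by positivity))).eventually_ge_atTop 100
  obtain ⟨n₀, hn₀⟩ := eventually_atTop.1 (hev1.and (hev2.and (eventually_ge_atTop 2)))
  -- That is, `w(n) = n^(σ/12) / (2b³ (log n)^4) - 3`, which depends only on `σ` and `b` and tends
  -- to infinity.
  refine ⟨n₀, fun n => Real.exp (σ / 12 * Real.log n) / Real.log n ^ (4 : ℝ) / (2 * b ^ 3) - 3,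
    ?_, ?_⟩
  · have h1 := (tendsto_exp_mul_div_rpow_atTop 4 (σ / 12) (by positivity)).comp hlogn
    exact tendsto_atTop_add_const_right _ _ (h1.atTop_div_const (by positivity))
  · intro γ hγ0 hγ1 hγ n hn r hr2 hr m hm hm' D hD α _ H hV hU hdeg hcodeg
    obtain ⟨hlog, hsmall, hn2⟩ := hn₀ n hn
    have R := regular_of_parameters hn2 hlog hsmall hγ0 hγ1 hγ hr2 hr hm hD hV hU hdeg hcodeg
    have hm0 := R.m_pos
    have hN : γ ≤ 1 - (⌊(1 - γ) * m⌋₊ : ℝ) / m := by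
      have h1 : (⌊(1 - γ) * m⌋₊ : ℝ) ≤ (1 - γ) * m :=
        Nat.floor_le (mul_nonneg (by linarith) hm0.le)
      have h2 : (⌊(1 - γ) * m⌋₊ : ℝ) / m ≤ 1 - γ := by rwa [div_le_iff₀ hm0]
      linarith
    have h1 := R.one_sub_potential_le _ hN
    have h2 := failure_bound hn2 hb hσ hr2 hr hm hm' R
    refine le_trans (by linarith) (h1.trans (ENNReal.toReal_mono ?_ ?_))
    · refine ne_top_of_le_ne_top ENNReal.one_ne_top ?_
      rw [PMF.toOuterMeasure_apply, ← PMF.tsum_coe]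
      exact ENNReal.tsum_le_tsum fun b => Set.indicator_le_self _ _ _
    · exact MeasureTheory.measure_mono fun h hh => hh.concentrated R hN
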